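/- Let $\mathbb{K}$ be a field. **Diagrams.** A graph (with free ends) consists of a finite set $V$ of vertices, a finite set $E$ of lines and partially defined maps $h,t:E\rightharpoonup V$ (head and tail) such that for every line at least one of $h,t$ is defined, every vertex is the head or the tail of some line, and there is no cycle, i.e. no lines $e_1,\dots,e_n$ ($n\ge 1$) with $h(e_k)=t(e_{k+1})$ for $k<n$ and $h(e_n)=t(e_1)$. A Heisenberg–Weyl diagram is an isomorphism class of such graphs. A line of $\Gamma$ is inner if both ends are attached, incoming if its tail is free, outgoing if its head is free; the sets of these lines are $\Gamma^{0},\Gamma^{-},\Gamma^{+}$. The void diagram $\text{Ø}$ has no lines and no vertices. For a set $L\subseteq E_\Gamma$ of lines, $\Gamma|_L$ is the diagram with lines $L$ and with the ends of these lines as vertices. A matching $m$ of $\Gamma_2^{-}$ and $\Gamma_1^{+}$ is a set of pairs in $\Gamma_2^{-}\times\Gamma_1^{+}$ no two of which share a component, and $\Gamma_2\bullet_m\Gamma_1$ is the diagram obtained from the disjoint union of $\Gamma_2$ and $\Gamma_1$ by replacing each pair $(e_2,e_1)\in m$ of lines by one inner line with the head of $e_2$ and the tail of $e_1$. **The algebra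 $\mathcal{G}$.** Let $\mathcal{G}$ be the $\mathbb{K}$-vector space with basis all Heisenberg–Weyl diagrams, with unit $\text{Ø}$ and with the linear structure maps given on basis elements by $$\Gamma_2*\Gamma_1=\sum_{m}\Gamma_2\bullet_m\Gamma_1,\qquad \Delta(\Gamma)=\sum_{L\sqcup R=E_\Gamma}\Gamma|_L\otimes\Gamma|_R,\qquad \varepsilon(\Gamma)=\begin{cases}1&\Gamma=\text{Ø}\\0&\text{otherwise,}\end{cases}$$ $$S(\text{Ø})=\text{Ø},\qquad S(\Gamma)=\sum_{n\ge1}\ \sum_{\substack{A_n\sqcup\dots\sqcup A_1=E_\Gamma\\ A_n,\dots,A_1\ne\emptyset}}(-1)^n\,\Gamma|_{A_n}*\dots*\Gamma|_{A_1}\quad(\Gamma\ne\text{Ø}),$$ where $m$ runs over all matchings of $\Gamma_2^{-}$ and $\Gamma_1^{+}$, and the other sums run over ordered partitions of the set of lines. **The enveloping algebra.** Let $\mathcal{L}_{\mathcal{H}}$ be the Heisenberg Lie algebra over $\mathbb{K}$, with basis $a^\dagger,a,e$ and brackets $[a,a^\dagger]=e$, $[a^\dagger,e]=[a,e]=0$,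 and let its enveloping algebra $\mathcal{U}(\mathcal{L}_{\mathcal{H}})$ carry the standard Hopf algebra structure, in which $\Delta(x)=x\otimes 1+1\otimes x$, $\varepsilon(x)=0$, $S(x)=-x$ for $x\in\mathcal{L}_{\mathcal{H}}$. **Theorem.** $(\mathcal{G},+,*,\text{Ø},\Delta,\varepsilon,S)$ is a Hopf algebra, and the forgetful map, i.e. the linear map $\varphi:\mathcal{G}\to\mathcal{U}(\mathcal{L}_{\mathcal{H}})$ given on diagrams by $$\varphi(\Gamma)=(a^\dagger)^{|\Gamma^{+}|}\,a^{|\Gamma^{-}|}\,e^{|\Gamma^{0}|},$$ is a Hopf algebra morphism: it is a morphism of unital algebras, and $$(\varphi\otimes\varphi)\circ\Delta=\Delta\circ\varphi,\qquad \varepsilon=\varepsilon\circ\varphi,\qquad \varphi\circ S=S\circ\varphi .$$ -/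

import Mathlib

open scoped TensorProduct

noncomputable section

/-! ## Graphs with free ends and diagrams -/

/-- A representative of a Heisenberg-Weyl diagram: a finite directed multigraph in which at most
one of the two ends of each line is free (a free end is recorded by `none`), which has no directed
cycle, and in which each vertex is the end of some line. -/
structure HWGraph where
  /-- vertices -/
  V : Type
  /-- lines -/
  E : Type
  finV : Finite V
  finE : Finite E
  /-- head of a line, `none` when the head is free -/
  head : E → Option V
  /-- tail of a line, `none` when the tail is free -/
  tail : E → Option V
  /-- no line has both ends free -/
  attached : ∀ e, head e ≠ none ∨ tail e ≠ none
  /-- no isolated vertices -/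
  covered : ∀ v, ∃ e, head e = some v ∨ tail e = some v
  /-- there is no sequence `e₁, …, eₙ` (`n ≥ 1`) of lines in which the head of each line is the
  tail of the next one and the head of `eₙ` is the tail of `e₁` -/
  acyclic : ∀ e, ¬ Relation.TransGen (fun e f => ∃ v, head e = some v ∧ tail f = some v) e e

namespace HWGraph

instance (Γ : HWGraph) : Finite Γ.V := Γ.finV

instance (Γ : HWGraph) : Finite Γ.E := Γ.finE

instance (Γ : HWGraph) : Fintype Γ.E := Fintype.ofFinite _

/-- Inner lines: both ends are attached to vertices. -/
abbrev Inner (Γ : HWGraph) : Type := {e : Γ.E // Γ.head e ≠ none ∧ Γ.tail e ≠ none}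

/-- Incoming lines: the tail is free. -/
abbrev Incoming (Γ : HWGraph) : Type := {e : Γ.E // Γ.tail e = none}

/-- Outgoing lines: the head is free. -/
abbrev Outgoing (Γ : HWGraph) : Type := {e : Γ.E // Γ.head e = none}

/-- An isomorphism of graphs with free ends. -/
structure Iso (Γ Γ' : HWGraph) where
  onE : Γ.E ≃ Γ'.E
  onV : Γ.V ≃ Γ'.V
  head_eq : ∀ e, Γ'.head (onE e) = (Γ.head e).map onV
  tail_eq : ∀ e, Γ'.tail (onE e) = (Γ.tail e).map onV

/-- The identity isomorphism. -/
def Iso.refl (Γ : HWGraph) : Iso Γ Γ := ⟨Equiv.refl _, Equiv.refl _, by simp, by simp⟩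

/-- The inverse isomorphism. -/
def Iso.symm {Γ Γ' : HWGraph} (i : Iso Γ Γ') : Iso Γ' Γ where
  onE := i.onE.symm
  onV := i.onV.symm
  head_eq e := by
    have h := i.head_eq (i.onE.symm e)
    rw [Equiv.apply_symm_apply] at h
    simp [h]
  tail_eq e := by
    have h := i.tail_eq (i.onE.symm e)
    rw [Equiv.apply_symm_apply] at h
    simp [h]

/-- Composition of isomorphisms. -/
def Iso.trans {Γ Γ' Γ'' : HWGraph} (i : Iso Γ Γ') (j : Iso Γ' Γ'') : Iso Γ Γ'' where
  onE := i.onE.trans j.onE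
  onV := i.onV.trans j.onV
  head_eq e := by simp [i.head_eq, j.head_eq]
  tail_eq e := by simp [i.tail_eq, j.tail_eq]

instance setoid : Setoid HWGraph where
  r Γ Γ' := Nonempty (Iso Γ Γ')
  iseqv := ⟨fun Γ => ⟨Iso.refl Γ⟩, fun ⟨i⟩ => ⟨i.symm⟩, fun ⟨i⟩ ⟨j⟩ => ⟨i.trans j⟩⟩

/-- The void graph: no vertices and no lines. -/
def void : HWGraph where
  V := Empty
  E := Empty
  finV := inferInstance
  finE := inferInstance
  head := Empty.elim
  tail := Empty.elim
  attached := fun e => e.elim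
  covered := fun v => v.elim
  acyclic := fun e => e.elim

/-! ### Restriction to a set of lines -/

/-- The subgraph induced by a set `L` of lines: its lines are those of `L`, and its vertices are
the ends of the lines of `L`. -/
def restrict (Γ : HWGraph) (L : Set Γ.E) : HWGraph where
  V := {v : Γ.V // ∃ e ∈ L, Γ.head e = some v ∨ Γ.tail e = some v}
  E := L
  finV := inferInstance
  finE := inferInstance
  head e := (Γ.head e).pmap Subtype.mk fun _ hv => ⟨e, e.2, Or.inl hv⟩
  tail e := (Γ.tail e).pmap Subtype.mk fun _ hv => ⟨e, e.2, Or.inr hv⟩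
  attached e := by simpa using Γ.attached e
  covered := by
    rintro ⟨v, e, he, h⟩
    refine ⟨⟨e, he⟩, ?_⟩
    refine h.imp (fun h => ?_) (fun h => ?_)
    · exact Option.pmap_eq_some_iff.2 ⟨v, _, h, rfl⟩
    · exact Option.pmap_eq_some_iff.2 ⟨v, _, h, rfl⟩
  acyclic e h := by
    refine Γ.acyclic e (Relation.TransGen.lift (f := Subtype.val) ?_ e e h)
    rintro a b ⟨v, ha, hb⟩
    rw [Option.pmap_eq_some_iff] at ha hb
    obtain ⟨x, hx, h1, rfl⟩ := ha
    obtain ⟨y, hy, h2, h3⟩ := hb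
    refine ⟨x, h1, ?_⟩
    rw [h2, Subtype.mk.inj h3]

/-! ### Composition along a matching -/

/-- A matching of `A` and `B`: a (finite) set of pairs all having different components. -/
def Matching (A B : Type) : Type :=
  {m : Finset (A × B) // ∀ p ∈ m, ∀ q ∈ m, p.1 = q.1 ∨ p.2 = q.2 → p = q}

instance (A B : Type) [Finite A] [Finite B] : Finite (Matching A B) :=
  inferInstanceAs (Finite {m : Finset (A × B) //
    ∀ p ∈ m, ∀ q ∈ m, p.1 = q.1 ∨ p.2 = q.2 → p = q})

instance (A B : Type) [Finite A] [Finite B] : Fintype (Matching A B) := Fintype.ofFinite _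

/-- Lines of the composite of `Γ₂` and `Γ₁` along `m`: the lines of `Γ₂` that are not matched, the
lines of `Γ₁` that are not matched, and the pairs in `m`. -/
abbrev CompE (Γ₂ Γ₁ : HWGraph) (m : Matching Γ₂.Incoming Γ₁.Outgoing) : Type :=
  {e : Γ₂.E // ∀ p ∈ m.1, p.1.1 ≠ e} ⊕ {e : Γ₁.E // ∀ p ∈ m.1, p.2.1 ≠ e} ⊕ {p // p ∈ m.1}

/-- Heads of the lines of a composite. -/
def compHead (Γ₂ Γ₁ : HWGraph) (m : Matching Γ₂.Incoming Γ₁.Outgoing) :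
    CompE Γ₂ Γ₁ m → Option (Γ₂.V ⊕ Γ₁.V)
  | .inl e => (Γ₂.head e.1).map Sum.inl
  | .inr (.inl e) => (Γ₁.head e.1).map Sum.inr
  | .inr (.inr p) => (Γ₂.head p.1.1.1).map Sum.inl

/-- Tails of the lines of a composite. -/
def compTail (Γ₂ Γ₁ : HWGraph) (m : Matching Γ₂.Incoming Γ₁.Outgoing) :
    CompE Γ₂ Γ₁ m → Option (Γ₂.V ⊕ Γ₁.V)
  | .inl e => (Γ₂.tail e.1).map Sum.inl
  | .inr (.inl e) => (Γ₁.tail e.1).map Sum.inr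
  | .inr (.inr p) => (Γ₁.tail p.1.2.1).map Sum.inr

theorem comp_acyclic (Γ₂ Γ₁ : HWGraph) (m : Matching Γ₂.Incoming Γ₁.Outgoing)
    (x : CompE Γ₂ Γ₁ m) :
    ¬ Relation.TransGen
      (fun e f => ∃ v, compHead Γ₂ Γ₁ m e = some v ∧ compTail Γ₂ Γ₁ m f = some v) x x := by
  -- each step stays among the lines of one factor, or passes from the first to the second one
  have key : ∀ x y, Relation.TransGen
      (fun e f => ∃ v, compHead Γ₂ Γ₁ m e = some v ∧ compTail Γ₂ Γ₁ m f = some v) x y →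
      (match x, y with
        | .inl e, .inl f => Relation.TransGen
            (fun e f => ∃ v, Γ₂.head e = some v ∧ Γ₂.tail f = some v) e.1 f.1
        | .inr (.inl e), .inr (.inl f) => Relation.TransGen
            (fun e f => ∃ v, Γ₁.head e = some v ∧ Γ₁.tail f = some v) e.1 f.1
        | .inl _, .inr _ => False
        | .inr (.inr _), .inr _ => False
        | _, _ => True) := by
    intro x y h
    induction h with
    | single h =>
      rename_i y
      rcases x with e | e | p <;> rcases y with f | f | q <;>
        simp [compHead, compTail] at h ⊢
      · exact .single h
      · exact .single h
    | tail _ h ih =>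
      rename_i y z _
      rcases x with e | e | p <;> rcases y with f | f | q <;> rcases z with g | g | r <;>
        simp [compHead, compTail] at h ih ⊢
      · exact ih.tail h
      · exact ih.tail h
  intro h
  have := key x x h
  rcases x with e | e | p
  · exact Γ₂.acyclic _ this
  · exact Γ₁.acyclic _ this
  · exact this

/-- The composite of `Γ₂` and `Γ₁` along a matching `m` between the incoming lines of `Γ₂` and the
outgoing lines of `Γ₁`: matched lines are joined. -/
def comp (Γ₂ Γ₁ : HWGraph) (m : Matching Γ₂.Incoming Γ₁.Outgoing) : HWGraph where
  V := Γ₂.V ⊕ Γ₁.V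
  E := CompE Γ₂ Γ₁ m
  finV := inferInstance
  finE := inferInstance
  head := compHead Γ₂ Γ₁ m
  tail := compTail Γ₂ Γ₁ m
  attached := by
    rintro (e | e | p)
    · simpa [compHead, compTail] using Γ₂.attached e
    · simpa [compHead, compTail] using Γ₁.attached e
    · left
      have := Γ₂.attached p.1.1.1
      simpa [compHead, p.1.1.2] using this
  covered := by
    rintro (v | v)
    · obtain ⟨e, he⟩ := Γ₂.covered v
      by_cases hm : ∃ p ∈ m.1, p.1.1 = e
      · obtain ⟨p, hp, rfl⟩ := hm
        refine ⟨.inr (.inr ⟨p, hp⟩), ?_⟩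
        have := p.1.2
        simpa [compHead, compTail, this] using he
      · push Not at hm
        exact ⟨.inl ⟨e, hm⟩, by simpa [compHead, compTail] using he⟩
    · obtain ⟨e, he⟩ := Γ₁.covered v
      by_cases hm : ∃ p ∈ m.1, p.2.1 = e
      · obtain ⟨p, hp, rfl⟩ := hm
        refine ⟨.inr (.inr ⟨p, hp⟩), ?_⟩
        have := p.2.2
        simpa [compHead, compTail, this] using he
      · push Not at hm
        exact ⟨.inr (.inl ⟨e, hm⟩), by simpa [compHead, compTail] using he⟩
  acyclic := comp_acyclic Γ₂ Γ₁ m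

/-! ### Invariance under isomorphism -/

/-- An isomorphism restricts to induced subgraphs. -/
def Iso.restrict {Γ Γ' : HWGraph} (i : Iso Γ Γ') (L : Set Γ.E) (L' : Set Γ'.E)
    (h : ∀ e, e ∈ L ↔ i.onE e ∈ L') : Iso (Γ.restrict L) (Γ'.restrict L') where
  onE := i.onE.subtypeEquiv h
  onV := i.onV.subtypeEquiv fun v => by
    rw [i.onE.exists_congr_left]
    refine exists_congr fun e => ?_
    have h1 := i.symm.head_eq e
    have h2 := i.symm.tail_eq e
    rw [h]
    simp only [Iso.symm] at h1 h2
    simp [h1, h2, Equiv.symm_apply_eq]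
  head_eq e := by
    have h1 := i.head_eq e.1
    simp only [HWGraph.restrict]
    obtain h2 | ⟨v, h2⟩ : Γ.head e.1 = none ∨ ∃ v, Γ.head e.1 = some v := by
      cases Γ.head e.1 <;> simp
    · rw [h2] at h1
      refine (Option.pmap_eq_none_iff.2 h1).trans ?_
      rw [Option.pmap_eq_none_iff.2 h2, Option.map_none]
    · rw [h2] at h1
      refine (Option.pmap_eq_some_iff.2 ⟨i.onV v, ⟨i.onE e.1, (h e.1).1 e.2, Or.inl h1⟩,
        h1, rfl⟩).trans ?_
      rw [Option.pmap_eq_some_iff.2 ⟨v, ⟨e.1, e.2, Or.inl h2⟩, h2, rfl⟩]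
      rfl
  tail_eq e := by
    have h1 := i.tail_eq e.1
    simp only [HWGraph.restrict]
    obtain h2 | ⟨v, h2⟩ : Γ.tail e.1 = none ∨ ∃ v, Γ.tail e.1 = some v := by
      cases Γ.tail e.1 <;> simp
    · rw [h2] at h1
      refine (Option.pmap_eq_none_iff.2 h1).trans ?_
      rw [Option.pmap_eq_none_iff.2 h2, Option.map_none]
    · rw [h2] at h1
      refine (Option.pmap_eq_some_iff.2 ⟨i.onV v, ⟨i.onE e.1, (h e.1).1 e.2, Or.inr h1⟩,
        h1, rfl⟩).trans ?_
      rw [Option.pmap_eq_some_iff.2 ⟨v, ⟨e.1, e.2, Or.inr h2⟩, h2, rfl⟩]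
      rfl

/-- Incoming lines correspond under an isomorphism. -/
def Iso.incoming {Γ Γ' : HWGraph} (i : Iso Γ Γ') : Γ.Incoming ≃ Γ'.Incoming :=
  i.onE.subtypeEquiv fun e => by simp [i.tail_eq]

/-- Outgoing lines correspond under an isomorphism. -/
def Iso.outgoing {Γ Γ' : HWGraph} (i : Iso Γ Γ') : Γ.Outgoing ≃ Γ'.Outgoing :=
  i.onE.subtypeEquiv fun e => by simp [i.head_eq]

/-- Inner lines correspond under an isomorphism. -/
def Iso.inner {Γ Γ' : HWGraph} (i : Iso Γ Γ') : Γ.Inner ≃ Γ'.Inner :=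
  i.onE.subtypeEquiv fun e => by simp [i.head_eq, i.tail_eq]

/-- Matchings correspond under bijections. -/
def Matching.congr {A A' B B' : Type} (f : A ≃ A') (g : B ≃ B') :
    Matching A B ≃ Matching A' B' :=
  (f.prodCongr g).finsetCongr.subtypeEquiv fun m => by
    rw [(f.prodCongr g).forall_congr_left]
    refine forall_congr' fun p => imp_congr (by simp [Equiv.finsetCongr]) ?_
    rw [(f.prodCongr g).forall_congr_left]
    refine forall_congr' fun q => imp_congr (by simp [Equiv.finsetCongr]) ?_
    rw [(f.prodCongr g).symm.injective.eq_iff]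
    simp

theorem Matching.mem_congr {A A' B B' : Type} (f : A ≃ A') (g : B ≃ B') (m : Matching A B)
    (p : A × B) : p ∈ m.1 ↔ f.prodCongr g p ∈ (Matching.congr f g m).1 := by
  change _ ↔ f.prodCongr g p ∈ Finset.map (f.prodCongr g).toEmbedding m.1
  rw [Finset.mem_map_equiv, Equiv.symm_apply_apply]

/-- Composites along corresponding matchings are isomorphic. -/
def Iso.comp {Γ₂ Γ₂' Γ₁ Γ₁' : HWGraph} (i₂ : Iso Γ₂ Γ₂') (i₁ : Iso Γ₁ Γ₁')
    (m : Matching Γ₂.Incoming Γ₁.Outgoing) :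
    Iso (Γ₂.comp Γ₁ m) (Γ₂'.comp Γ₁' (Matching.congr i₂.incoming i₁.outgoing m)) where
  onE := Equiv.sumCongr
    (i₂.onE.subtypeEquiv fun e => by
      rw [← (Equiv.prodCongr i₂.incoming i₁.outgoing).forall_congr_right]
      refine forall_congr' fun p => imp_congr (Matching.mem_congr _ _ _ _) ?_
      exact (i₂.onE.injective.ne_iff).symm)
    (Equiv.sumCongr
      (i₁.onE.subtypeEquiv fun e => by
        rw [← (Equiv.prodCongr i₂.incoming i₁.outgoing).forall_congr_right]
        refine forall_congr' fun p => imp_congr (Matching.mem_congr _ _ _ _) ?_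
        exact (i₁.onE.injective.ne_iff).symm)
      ((Equiv.prodCongr i₂.incoming i₁.outgoing).subtypeEquiv fun p =>
        Matching.mem_congr _ _ _ _))
  onV := Equiv.sumCongr i₂.onV i₁.onV
  head_eq := by
    rintro (e | e | p)
    · change Option.map Sum.inl (Γ₂'.head (i₂.onE e.1)) =
        ((Γ₂.head e.1).map Sum.inl).map (Equiv.sumCongr i₂.onV i₁.onV)
      simp [i₂.head_eq, Function.comp_def]
    · change Option.map Sum.inr (Γ₁'.head (i₁.onE e.1)) =
        ((Γ₁.head e.1).map Sum.inr).map (Equiv.sumCongr i₂.onV i₁.onV)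
      simp [i₁.head_eq, Function.comp_def]
    · change Option.map Sum.inl (Γ₂'.head (i₂.onE p.1.1.1)) =
        ((Γ₂.head p.1.1.1).map Sum.inl).map (Equiv.sumCongr i₂.onV i₁.onV)
      simp [i₂.head_eq, Function.comp_def]
  tail_eq := by
    rintro (e | e | p)
    · change Option.map Sum.inl (Γ₂'.tail (i₂.onE e.1)) =
        ((Γ₂.tail e.1).map Sum.inl).map (Equiv.sumCongr i₂.onV i₁.onV)
      simp [i₂.tail_eq, Function.comp_def]
    · change Option.map Sum.inr (Γ₁'.tail (i₁.onE e.1)) =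
        ((Γ₁.tail e.1).map Sum.inr).map (Equiv.sumCongr i₂.onV i₁.onV)
      simp [i₁.tail_eq, Function.comp_def]
    · change Option.map Sum.inr (Γ₁'.tail (i₁.onE p.1.2.1)) =
        ((Γ₁.tail p.1.2.1).map Sum.inr).map (Equiv.sumCongr i₂.onV i₁.onV)
      simp [i₁.tail_eq, Function.comp_def]

end HWGraph

/-- A Heisenberg-Weyl diagram: an isomorphism class of graphs with free ends. -/
def Diagram : Type 1 := Quotient HWGraph.setoid

namespace Diagram

/-- The diagram represented by a graph. -/
def mk (Γ : HWGraph) : Diagram := Quotient.mk _ Γ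

theorem mk_eq {Γ Γ' : HWGraph} (i : HWGraph.Iso Γ Γ') : mk Γ = mk Γ' := Quotient.sound ⟨i⟩

/-- The void diagram. -/
def void : Diagram := mk HWGraph.void

/-- The number of outgoing lines. -/
def numOut : Diagram → ℕ :=
  Quotient.lift (fun Γ => Nat.card Γ.Outgoing) fun _ _ ⟨i⟩ => Nat.card_congr i.outgoing

/-- The number of incoming lines. -/
def numIn : Diagram → ℕ :=
  Quotient.lift (fun Γ => Nat.card Γ.Incoming) fun _ _ ⟨i⟩ => Nat.card_congr i.incoming

/-- The number of inner lines. -/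
def numInner : Diagram → ℕ :=
  Quotient.lift (fun Γ => Nat.card Γ.Inner) fun _ _ ⟨i⟩ => Nat.card_congr i.inner

end Diagram

/-! ## The algebra of diagrams -/

/-- The vector space over `K` whose basis is the set of all diagrams. -/
def DiagramAlg (K : Type*) [Field K] := Diagram →₀ K

namespace DiagramAlg

variable (K : Type*) [Field K]

instance : AddCommGroup (DiagramAlg K) := inferInstanceAs (AddCommGroup (Diagram →₀ K))

instance : Module K (DiagramAlg K) := inferInstanceAs (Module K (Diagram →₀ K))

/-- The basis of all diagrams. -/
def basis : Module.Basis Diagram K (DiagramAlg K) := .ofRepr (LinearEquiv.refl K (Diagram →₀ K))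

/-- A diagram as an element of the vector space of diagrams. -/
def of (D : Diagram) : DiagramAlg K := basis K D

/-- The product of two diagrams: the sum of all their composites. -/
def mulDiagram : Diagram → Diagram → DiagramAlg K :=
  Quotient.lift₂
    (fun Γ₂ Γ₁ => ∑ m : HWGraph.Matching Γ₂.Incoming Γ₁.Outgoing, of K (.mk (Γ₂.comp Γ₁ m)))
    fun _ _ _ _ ⟨i₂⟩ ⟨i₁⟩ => Fintype.sum_equiv (HWGraph.Matching.congr i₂.incoming i₁.outgoing) _ _
      fun m => congrArg (of K) (Diagram.mk_eq (i₂.comp i₁ m))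

/-- The multiplication of the algebra of diagrams. -/
def mul : DiagramAlg K →ₗ[K] DiagramAlg K →ₗ[K] DiagramAlg K :=
  (basis K).constr K fun D₂ => (basis K).constr K fun D₁ => mulDiagram K D₂ D₁

/-- The unit of the algebra of diagrams: the void diagram. -/
def one : DiagramAlg K := of K Diagram.void

/-- The coproduct of a diagram: the sum over all ordered partitions `L + R` of its lines into two
subsets. -/
def comulDiagram : Diagram → DiagramAlg K ⊗[K] DiagramAlg K :=
  Quotient.lift
    (fun Γ => ∑ L : Set Γ.E, of K (.mk (Γ.restrict L)) ⊗ₜ[K] of K (.mk (Γ.restrict Lᶜ)))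
    fun _ _ ⟨i⟩ => Fintype.sum_equiv (Equiv.Set.congr i.onE) _ _ fun L => by
      rw [Diagram.mk_eq (i.restrict L (Equiv.Set.congr i.onE L) (by simp)),
        Diagram.mk_eq (i.restrict Lᶜ (Equiv.Set.congr i.onE L)ᶜ (by simp))]

/-- The coproduct. -/
def comul : DiagramAlg K →ₗ[K] DiagramAlg K ⊗[K] DiagramAlg K :=
  (basis K).constr K (comulDiagram K)

/-- The counit: the coefficient of the void diagram. -/
def counit : DiagramAlg K →ₗ[K] K := (basis K).coord Diagram.void

open scoped Classical in
/-- The antipode of a diagram: the alternating sum, over all ordered partitions of its lines into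
`n` nonempty subsets, of the products of the induced diagrams. The partitions into `n` nonempty
subsets are given by the surjective maps `c` from the lines to `Fin n`; there are none for `n`
larger than the number of lines. For the void diagram the only term is the empty product
(`n = 0`), which is the void diagram. -/
def antipodeDiagram : Diagram → DiagramAlg K :=
  Quotient.lift
    (fun Γ => ∑ n ∈ Finset.range (Nat.card Γ.E + 1),
      ∑ c : {c : Γ.E → Fin n // Function.Surjective c},
        (-1 : K) ^ n • (List.ofFn fun k : Fin n => of K (.mk (Γ.restrict (c.1 ⁻¹' {k})))).foldr
          (fun x y => mul K x y) (one K))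
    fun Γ Γ' ⟨i⟩ => by
      rw [Nat.card_congr i.onE]
      refine Finset.sum_congr rfl fun n _ => ?_
      refine Fintype.sum_equiv ((i.onE.arrowCongr (Equiv.refl (Fin n))).subtypeEquiv
        fun c => ?_) _ _ fun c => ?_
      · simp [Equiv.arrowCongr]
      · congr 3
        funext k
        exact congrArg (of K) (Diagram.mk_eq (i.restrict _ _ fun e => by simp [Equiv.arrowCongr]))

/-- The antipode. -/
def antipode : DiagramAlg K →ₗ[K] DiagramAlg K := (basis K).constr K (antipodeDiagram K)

end DiagramAlg

/-! ## Enveloping algebras as Hopf algebras -/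

namespace UniversalEnvelopingAlgebra

variable (K : Type*) [Field K] {L : Type*} [LieRing L] [LieAlgebra K L]

attribute [local instance 100] LieRing.ofAssociativeRing

/-- The Lie algebra morphism `x ↦ x ⊗ 1 + 1 ⊗ x`. -/
def primitive : L →ₗ⁅K⁆ UniversalEnvelopingAlgebra K L ⊗[K] UniversalEnvelopingAlgebra K L where
  toFun x := ι K x ⊗ₜ[K] 1 + 1 ⊗ₜ[K] ι K x
  map_add' x y := by simp [TensorProduct.add_tmul, TensorProduct.tmul_add]; abel
  map_smul' r x := by simp [TensorProduct.smul_tmul']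
  map_lie' {x y} := by
    simp only [LieHom.map_lie, LieRing.of_associative_ring_bracket, mul_add, add_mul,
      Algebra.TensorProduct.tmul_mul_tmul, one_mul, mul_one, TensorProduct.sub_tmul,
      TensorProduct.tmul_sub]
    abel

/-- The coproduct: the algebra morphism with `Δ x = x ⊗ 1 + 1 ⊗ x` on the Lie algebra. -/
def comulHom : UniversalEnvelopingAlgebra K L →ₐ[K]
    UniversalEnvelopingAlgebra K L ⊗[K] UniversalEnvelopingAlgebra K L := lift K (primitive K)

/-- The counit: the algebra morphism that vanishes on the Lie algebra. -/
def counitHom : UniversalEnvelopingAlgebra K L →ₐ[K] K := lift K 0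

/-- The Lie algebra morphism `x ↦ -x` into the opposite algebra. -/
def negOp : L →ₗ⁅K⁆ (UniversalEnvelopingAlgebra K L)ᵐᵒᵖ where
  toFun x := MulOpposite.op (-ι K x)
  map_add' x y := by simp [add_comm]
  map_smul' r x := by simp
  map_lie' {x y} := by
    simp [LieRing.of_associative_ring_bracket, ← MulOpposite.op_mul, ← MulOpposite.op_sub]

/-- The antipode as an algebra morphism into the opposite algebra: `S x = -x` on the Lie
algebra. -/
def antipodeHom : UniversalEnvelopingAlgebra K L →ₐ[K] (UniversalEnvelopingAlgebra K L)ᵐᵒᵖ :=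
  lift K (negOp K)

theorem comulHom_ι (x : L) : comulHom K (ι K x) = ι K x ⊗ₜ[K] 1 + 1 ⊗ₜ[K] ι K x :=
  lift_ι_apply K (primitive K) x

theorem counitHom_ι (x : L) : counitHom K (ι K x) = 0 := lift_ι_apply K 0 x

theorem antipodeHom_ι (x : L) : antipodeHom K (ι K x) = MulOpposite.op (-ι K x) :=
  lift_ι_apply K (negOp K) x

/-- The enveloping algebra is generated by the Lie algebra. -/
theorem induction_ι {p : UniversalEnvelopingAlgebra K L → Prop}
    (algebraMap : ∀ r, p (algebraMap K _ r)) (gen : ∀ x, p (ι K x))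
    (mul : ∀ x y, p x → p y → p (x * y)) (add : ∀ x y, p x → p y → p (x + y))
    (x : UniversalEnvelopingAlgebra K L) : p x := by
  obtain ⟨t, rfl⟩ : ∃ t, mkAlgHom K L t = x := Quotient.exists_rep x
  induction t using TensorAlgebra.induction with
  | algebraMap r => simpa using algebraMap r
  | ι x => exact gen x
  | mul a b ha hb => simpa using mul _ _ ha hb
  | add a b ha hb => simpa using add _ _ ha hb

instance : Bialgebra K (UniversalEnvelopingAlgebra K L) :=
  Bialgebra.ofAlgHom (comulHom K) (counitHom K)
    (hom_ext K (LieHom.ext fun x => by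
      change Algebra.TensorProduct.assoc K K K _ _ _
        (Algebra.TensorProduct.map (comulHom K) (.id K _) (comulHom K (ι K x))) =
        Algebra.TensorProduct.map (.id K _) (comulHom K) (comulHom K (ι K x))
      simp [-ι_apply, comulHom_ι, TensorProduct.add_tmul, TensorProduct.tmul_add,
        Algebra.TensorProduct.one_def, add_assoc]))
    (AlgHom.ext fun x => by
      induction x using induction_ι with
      | algebraMap r => rw [AlgHom.commutes, AlgHom.commutes]
      | gen x => simp [-ι_apply, comulHom_ι, counitHom_ι]
      | mul x y hx hy => rw [map_mul, map_mul, hx, hy]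
      | add x y hx hy => rw [map_add, map_add, hx, hy])
    (hom_ext K (LieHom.ext fun x => by
      change Algebra.TensorProduct.map (.id K _) (counitHom K) (comulHom K (ι K x)) =
        ι K x ⊗ₜ[K] 1
      simp [-ι_apply, comulHom_ι, counitHom_ι]))

/-- The antipode as a linear map. -/
def antipodeLin : UniversalEnvelopingAlgebra K L →ₗ[K] UniversalEnvelopingAlgebra K L :=
  (MulOpposite.opLinearEquiv K).symm.toLinearMap ∘ₗ (antipodeHom K).toLinearMap

theorem antipodeLin_ι (x : L) : antipodeLin K (ι K x) = -ι K x := by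
  simp [-ι_apply, antipodeLin, antipodeHom_ι]

theorem antipodeLin_mul (x y : UniversalEnvelopingAlgebra K L) :
    antipodeLin K (x * y) = antipodeLin K y * antipodeLin K x := by simp [antipodeLin]

theorem antipodeLin_algebraMap (r : K) :
    antipodeLin K (algebraMap K (UniversalEnvelopingAlgebra K L) r) = algebraMap K _ r := by
  simp [antipodeLin, MulOpposite.algebraMap_apply]

theorem antipode_left (x : UniversalEnvelopingAlgebra K L) :
    LinearMap.mul' K _ ((antipodeLin K).rTensor _ (comulHom K x)) =
      algebraMap K _ (counitHom K x) := by
  induction x using induction_ι with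
  | algebraMap r =>
    simp [Algebra.TensorProduct.algebraMap_apply, antipodeLin_algebraMap]
  | gen x =>
    have h : antipodeLin K (1 : UniversalEnvelopingAlgebra K L) = 1 := by
      simpa using antipodeLin_algebraMap K (L := L) 1
    simp [-ι_apply, comulHom_ι, counitHom_ι, antipodeLin_ι, h]
  | add x y hx hy => simp [hx, hy]
  | mul x y hx hy =>
    have key : ∀ t u : UniversalEnvelopingAlgebra K L ⊗[K] UniversalEnvelopingAlgebra K L,
        ∀ c : K, LinearMap.mul' K _ ((antipodeLin K).rTensor _ t) = algebraMap K _ c →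
        LinearMap.mul' K _ ((antipodeLin K).rTensor _ (t * u)) =
          c • LinearMap.mul' K _ ((antipodeLin K).rTensor _ u) := by
      intro t u c ht
      induction u with
      | zero => simp
      | add u v hu hv => simp [mul_add, hu, hv]
      | tmul b d =>
        have h : LinearMap.mul' K _ ((antipodeLin K).rTensor _ (t * b ⊗ₜ d)) =
            antipodeLin K b * LinearMap.mul' K _ ((antipodeLin K).rTensor _ t) * d := by
          clear ht
          induction t with
          | zero => simp
          | add u v hu hv => simp [add_mul, mul_add, hu, hv]
          | tmul p q => simp [antipodeLin_mul, mul_assoc]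
        rw [h, ht, ← Algebra.commutes]
        simp [Algebra.smul_def, mul_assoc]
    rw [map_mul, key _ _ _ hx, hy, map_mul, map_mul, Algebra.smul_def]

theorem antipode_right (x : UniversalEnvelopingAlgebra K L) :
    LinearMap.mul' K _ ((antipodeLin K).lTensor _ (comulHom K x)) =
      algebraMap K _ (counitHom K x) := by
  induction x using induction_ι with
  | algebraMap r =>
    have h : antipodeLin K (1 : UniversalEnvelopingAlgebra K L) = 1 := by
      simpa using antipodeLin_algebraMap K (L := L) 1
    simp [Algebra.TensorProduct.algebraMap_apply, h]
  | gen x =>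
    have h : antipodeLin K (1 : UniversalEnvelopingAlgebra K L) = 1 := by
      simpa using antipodeLin_algebraMap K (L := L) 1
    simp [-ι_apply, comulHom_ι, counitHom_ι, antipodeLin_ι, h]
  | add x y hx hy => simp [hx, hy]
  | mul x y hx hy =>
    have key : ∀ t u : UniversalEnvelopingAlgebra K L ⊗[K] UniversalEnvelopingAlgebra K L,
        ∀ c : K, LinearMap.mul' K _ ((antipodeLin K).lTensor _ u) = algebraMap K _ c →
        LinearMap.mul' K _ ((antipodeLin K).lTensor _ (t * u)) =
          c • LinearMap.mul' K _ ((antipodeLin K).lTensor _ t) := by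
      intro t u c hu
      induction t with
      | zero => simp
      | add u v hu hv => simp [add_mul, hu, hv]
      | tmul b d =>
        have h : LinearMap.mul' K _ ((antipodeLin K).lTensor _ (b ⊗ₜ d * u)) =
            b * LinearMap.mul' K _ ((antipodeLin K).lTensor _ u) * antipodeLin K d := by
          clear hu
          induction u with
          | zero => simp
          | add u v hu hv => simp [add_mul, mul_add, hu, hv]
          | tmul p q => simp [antipodeLin_mul, mul_assoc]
        rw [h, hu, ← Algebra.commutes]
        simp [Algebra.smul_def, mul_assoc]
    rw [map_mul, key _ _ _ hy, hx, map_mul, map_mul, Algebra.smul_def, Algebra.commutes]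

instance : HopfAlgebra K (UniversalEnvelopingAlgebra K L) where
  antipode := antipodeLin K
  mul_antipode_rTensor_comul := LinearMap.ext (antipode_left K)
  mul_antipode_lTensor_comul := LinearMap.ext (antipode_right K)

end UniversalEnvelopingAlgebra

/-! ## The Heisenberg Lie algebra -/

/-- The Heisenberg Lie algebra: the space `K³`, whose standard basis vectors of index `0`, `1`, `2`
are `a†`, `a`, `e`, with the bracket given by `[a, a†] = e`, `[a†, e] = [a, e] = 0`. -/
def HeisenbergLie (K : Type*) := Fin 3 → K

namespace HeisenbergLie

variable (K : Type*) [Field K]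

instance : AddCommGroup (HeisenbergLie K) := inferInstanceAs (AddCommGroup (Fin 3 → K))

instance : Module K (HeisenbergLie K) := inferInstanceAs (Module K (Fin 3 → K))

/-- The creation operator `a†`. -/
def aDag : HeisenbergLie K := ![1, 0, 0]

/-- The annihilation operator `a`. -/
def a : HeisenbergLie K := ![0, 1, 0]

/-- The central element `e`. -/
def e : HeisenbergLie K := ![0, 0, 1]

instance : LieRing (HeisenbergLie K) where
  bracket x y := (x 1 * y 0 - x 0 * y 1) • e K
  add_lie x y z := by
    change ((x 1 + y 1) * z 0 - (x 0 + y 0) * z 1) • e K = _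
    rw [← add_smul]; congr 1; ring
  lie_add x y z := by
    change (x 1 * (y 0 + z 0) - x 0 * (y 1 + z 1)) • e K = _
    rw [← add_smul]; congr 1; ring
  lie_self x := by
    change (x 1 * x 0 - x 0 * x 1) • e K = 0
    rw [mul_comm, sub_self, zero_smul]
  leibniz_lie x y z := by
    have h0 : ∀ c : K, (c • e K) 0 = 0 := fun c => mul_zero c
    have h1 : ∀ c : K, (c • e K) 1 = 0 := fun c => mul_zero c
    change (x 1 * ((_ : K) • e K) 0 - x 0 * ((_ : K) • e K) 1) • e K =
      (((_ : K) • e K) 1 * z 0 - ((_ : K) • e K) 0 * z 1) • e K +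
        (y 1 * ((_ : K) • e K) 0 - y 0 * ((_ : K) • e K) 1) • e K
    simp [h0, h1]

instance : LieAlgebra K (HeisenbergLie K) where
  lie_smul t x y := by
    change (x 1 * (t * y 0) - x 0 * (t * y 1)) • e K = t • (x 1 * y 0 - x 0 * y 1) • e K
    rw [smul_smul]; congr 1; ring

theorem lie_a_aDag : ⁅a K, aDag K⁆ = e K := by
  change ((1 : K) * 1 - 0 * 0) • e K = e K
  simp

theorem lie_aDag_e : ⁅aDag K, e K⁆ = 0 := by
  change ((0 : K) * 0 - 1 * 0) • e K = 0
  simp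

theorem lie_a_e : ⁅a K, e K⁆ = 0 := by
  change ((1 : K) * 0 - 0 * 0) • e K = 0
  simp

end HeisenbergLie

/-! ## The forgetful mapping -/

/-- The enveloping algebra of the Heisenberg Lie algebra. -/
abbrev UH (K : Type*) [Field K] := UniversalEnvelopingAlgebra K (HeisenbergLie K)

open UniversalEnvelopingAlgebra in
/-- The forgetful mapping, which sends a diagram with `k` outgoing, `l` incoming and `m` inner
lines to `a†ᵏ aˡ eᵐ`. -/
def forgetful (K : Type*) [Field K] : DiagramAlg K →ₗ[K] UH K :=
  (DiagramAlg.basis K).constr K fun D =>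
    ι K (HeisenbergLie.aDag K) ^ D.numOut * ι K (HeisenbergLie.a K) ^ D.numIn *
      ι K (HeisenbergLie.e K) ^ D.numInner

/-! ## Hopf algebra structures given by their structure maps -/

/-- The given multiplication, unit, coproduct, counit and antipode make the vector space `A` into
a Hopf algebra. -/
structure IsHopfAlgebra {K A : Type*} [Field K] [AddCommGroup A] [Module K A]
    (mul : A →ₗ[K] A →ₗ[K] A) (one : A) (comul : A →ₗ[K] A ⊗[K] A) (counit : A →ₗ[K] K)
    (antipode : A →ₗ[K] A) : Prop where
  mul_assoc : ∀ x y z, mul (mul x y) z = mul x (mul y z)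
  one_mul : ∀ x, mul one x = x
  mul_one : ∀ x, mul x one = x
  coassoc : (TensorProduct.assoc K A A A).toLinearMap ∘ₗ comul.rTensor A ∘ₗ comul =
    comul.lTensor A ∘ₗ comul
  counit_comul : ∀ x, counit.rTensor A (comul x) = 1 ⊗ₜ[K] x
  comul_counit : ∀ x, counit.lTensor A (comul x) = x ⊗ₜ[K] 1
  /-- the product on the right-hand side is the component-wise one -/
  comul_mul : ∀ x y, comul (mul x y) = TensorProduct.map₂ mul mul (comul x) (comul y)
  comul_one : comul one = one ⊗ₜ[K] one
  counit_mul : ∀ x y, counit (mul x y) = counit x * counit y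
  counit_one : counit one = 1
  antipode_mul_id : ∀ x, TensorProduct.lift mul (antipode.rTensor A (comul x)) = counit x • one
  id_mul_antipode : ∀ x, TensorProduct.lift mul (antipode.lTensor A (comul x)) = counit x • one

end

/-!
All sums in the Hopf algebra of diagrams run over combinatorial data on graphs that are built from
each other by composition and restriction. To compare such sums, all graphs in an identity are
presented inside one ambient `LineSystem`: a set `A` of lines together with a set `M` of pairs of
lines that are glued to each other determines a graph up to isomorphism (`LineSystem.Gluing.iso`).
In these terms the product of two disjoint graphs is the sum over all ways to enlarge the sets of
glued pairs by a matching (`LineSystem.mulDiagram_diagram`), and the coproduct is the sum over all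
subsets of `A` that do not separate glued pairs (`LineSystem.comulDiagram_diagram`). Associativity,
coassociativity and the compatibility of product and coproduct thereby become bijections between
families of sets: gluing three parts in either order means to choose a matching among all three of
them (`LineSystem.sum_pairings_assoc`), and to glue and then distribute the resulting lines is to
distribute the original lines and then glue on each side (`LineSystem.sum_pairings_saturated`).

For the antipode, let `r` be the identity minus the unit in the convolution ring of linear
endomorphisms. As `r` kills the void diagram, `r ^ n` is the sum over ordered partitions of the
lines into `n` nonempty subsets, and it vanishes on diagrams with fewer than `n` lines. Hence the
antipode is the geometric series in `-r`, locally a finite sum, and it is inverse to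
`1 - (-r)`, the identity.

The forgetful mapping is multiplicative because the number of matchings with `i` pairs between `l`
incoming and `k` outgoing lines is the coefficient of `a†^(k-i) a^(l-i) e^i` in the normal ordering
of `a^l a†^k` (`LineSystem.sum_pairings_ncard`, `pow_mul_pow_of_commutator`). It respects the
coproducts by the binomial theorem, as the lines of each of the three types are distributed
independently. It commutes with the antipodes because both composites are convolution inverses of
the forgetful mapping.
-/

noncomputable section

/-! ### Gluing graphs from a supply of lines -/

/-- Injections with the same range identify their domains. -/
def equivOfRangeEq {α β γ : Type*} (f : α → γ) (g : β → γ) (hf : Function.Injective f)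
    (hg : Function.Injective g) (h : Set.range f = Set.range g) : α ≃ β :=
  ((Equiv.ofInjective f hf).trans (Equiv.setCongr h)).trans (Equiv.ofInjective g hg).symm

theorem apply_equivOfRangeEq {α β γ : Type*} (f : α → γ) (g : β → γ) (hf : Function.Injective f)
    (hg : Function.Injective g) (h : Set.range f = Set.range g) (a : α) :
    g (equivOfRangeEq f g hf hg h a) = f a :=
  Equiv.apply_ofInjective_symm hg _

/-- A supply of lines from which graphs are glued: finitely many lines, each with an optional head
and an optional tail, at least one of which is present. Cycles and isolated vertices are
allowed: their absence is only needed of the graphs that are presented by such lines. -/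
structure LineSystem where
  /-- lines -/
  Line : Type
  /-- vertices -/
  Vertex : Type
  finite : Finite Line
  /-- head of a line, `none` when the head is free -/
  head : Line → Option Vertex
  /-- tail of a line, `none` when the tail is free -/
  tail : Line → Option Vertex
  attached : ∀ x, head x ≠ none ∨ tail x ≠ none

namespace LineSystem

variable (B : LineSystem)

instance : Finite B.Line := B.finite

/-- The vertices to which the lines in `A` are attached. -/
def ends (A : Set B.Line) : Set B.Vertex :=
  {v | ∃ x ∈ A, B.head x = some v ∨ B.tail x = some v}

/-- The lines in `A` with free tail that are not glued by `M` at their tail. -/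
def freeIn (A : Set B.Line) (M : Set (B.Line × B.Line)) : Set B.Line :=
  {x | x ∈ A ∧ B.tail x = none ∧ ∀ z, (x, z) ∉ M}

/-- The lines in `A` with free head that are not glued by `M` at their head. -/
def freeOut (A : Set B.Line) (M : Set (B.Line × B.Line)) : Set B.Line :=
  {x | x ∈ A ∧ B.head x = none ∧ ∀ z, (z, x) ∉ M}

/-- A presentation of `Γ` as the graph obtained from the lines in `A` by gluing, for every pair
`(x, y) ∈ M`, the free tail of `x` to the free head of `y`. A line of `Γ` is encoded by the ambient
line that provides its head and the one that provides its tail; they differ exactly for the glued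
lines. That `M` is a matching is not a separate field: it follows from the injectivity of
`headLine` and `tailLine`. -/
structure Gluing (A : Set B.Line) (M : Set (B.Line × B.Line)) (Γ : HWGraph) where
  /-- the ambient line that provides the head -/
  headLine : Γ.E → B.Line
  /-- the ambient line that provides the tail -/
  tailLine : Γ.E → B.Line
  /-- the ambient vertex of a vertex -/
  vertex : Γ.V → B.Vertex
  headLine_injective : Function.Injective headLine
  tailLine_injective : Function.Injective tailLine
  vertex_injective : Function.Injective vertex
  head_eq : ∀ e, B.head (headLine e) = (Γ.head e).map vertex
  tail_eq : ∀ e, B.tail (tailLine e) = (Γ.tail e).map vertex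
  glued : ∀ x y, (x, y) ∈ M → x ∈ A ∧ y ∈ A ∧ B.tail x = none ∧ B.head y = none
  exists_line_iff : ∀ x y, (∃ e, headLine e = x ∧ tailLine e = y) ↔
    (x, y) ∈ M ∨ (x = y ∧ x ∈ A ∧ ∀ z, (x, z) ∉ M ∧ (z, x) ∉ M)

variable {B}

theorem disjoint_of_ends {A₁ A₂ : Set B.Line}
    (h : Disjoint (B.ends A₂) (B.ends A₁)) : Disjoint A₂ A₁ := by
  rw [Set.disjoint_left] at h ⊢
  intro x h2 h1
  rcases B.attached x with hx | hx
  · obtain ⟨v, hv⟩ := Option.ne_none_iff_exists'.1 hx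
    exact h ⟨x, h2, .inl hv⟩ ⟨x, h1, .inl hv⟩
  · obtain ⟨v, hv⟩ := Option.ne_none_iff_exists'.1 hx
    exact h ⟨x, h2, .inr hv⟩ ⟨x, h1, .inr hv⟩

namespace Gluing

variable {A A₁ A₂ : Set B.Line} {M M₁ M₂ : Set (B.Line × B.Line)} {Γ Γ' Γ₁ Γ₂ : HWGraph}

theorem line_cases (P : B.Gluing A M Γ) (e : Γ.E) :
    (P.headLine e, P.tailLine e) ∈ M ∨ (P.headLine e = P.tailLine e ∧ P.headLine e ∈ A ∧
      ∀ z, (P.headLine e, z) ∉ M ∧ (z, P.headLine e) ∉ M) :=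
  (P.exists_line_iff _ _).1 ⟨e, rfl, rfl⟩

theorem headLine_mem (P : B.Gluing A M Γ) (e : Γ.E) : P.headLine e ∈ A := by
  rcases P.line_cases e with h | h
  · exact (P.glued _ _ h).1
  · exact h.2.1

theorem tailLine_mem (P : B.Gluing A M Γ) (e : Γ.E) : P.tailLine e ∈ A := by
  rcases P.line_cases e with h | h
  · exact (P.glued _ _ h).2.1
  · exact h.1 ▸ h.2.1

theorem exists_headLine (P : B.Gluing A M Γ) {x : B.Line} (hx : x ∈ A) (h : ∀ z, (z, x) ∉ M) :
    ∃ e, P.headLine e = x := by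
  by_cases h' : ∃ y, (x, y) ∈ M
  · obtain ⟨y, hy⟩ := h'
    obtain ⟨e, he, -⟩ := (P.exists_line_iff x y).2 (.inl hy)
    exact ⟨e, he⟩
  · push Not at h'
    obtain ⟨e, he, -⟩ := (P.exists_line_iff x x).2 (.inr ⟨rfl, hx, fun z => ⟨h' z, h z⟩⟩)
    exact ⟨e, he⟩

theorem exists_tailLine (P : B.Gluing A M Γ) {x : B.Line} (hx : x ∈ A) (h : ∀ z, (x, z) ∉ M) :
    ∃ e, P.tailLine e = x := by
  by_cases h' : ∃ y, (y, x) ∈ M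
  · obtain ⟨y, hy⟩ := h'
    obtain ⟨e, -, he⟩ := (P.exists_line_iff y x).2 (.inl hy)
    exact ⟨e, he⟩
  · push Not at h'
    obtain ⟨e, he, h⟩ := (P.exists_line_iff x x).2 (.inr ⟨rfl, hx, fun z => ⟨h z, h' z⟩⟩)
    exact ⟨e, h⟩

theorem vertex_mem_ends (P : B.Gluing A M Γ) (v : Γ.V) : P.vertex v ∈ B.ends A := by
  obtain ⟨e, h | h⟩ := Γ.covered v
  · exact ⟨_, P.headLine_mem e, .inl (by rw [P.head_eq, h]; rfl)⟩
  · exact ⟨_, P.tailLine_mem e, .inr (by rw [P.tail_eq, h]; rfl)⟩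

theorem range_vertex (P : B.Gluing A M Γ) : Set.range P.vertex = B.ends A := by
  refine Set.Subset.antisymm (Set.range_subset_iff.2 P.vertex_mem_ends) ?_
  rintro v ⟨x, hx, h | h⟩
  · obtain ⟨e, rfl⟩ := P.exists_headLine hx fun z hz => by simp [(P.glued _ _ hz).2.2.2] at h
    rw [P.head_eq, Option.map_eq_some_iff] at h
    obtain ⟨w, -, rfl⟩ := h
    exact ⟨w, rfl⟩
  · obtain ⟨e, rfl⟩ := P.exists_tailLine hx fun z hz => by simp [(P.glued _ _ hz).2.2.1] at h
    rw [P.tail_eq, Option.map_eq_some_iff] at h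
    obtain ⟨w, -, rfl⟩ := h
    exact ⟨w, rfl⟩

/-- The sets `A` and `M` determine the glued graph up to isomorphism. -/
def iso (P : B.Gluing A M Γ) (P' : B.Gluing A M Γ') : HWGraph.Iso Γ Γ' := by
  let c : Γ.E → B.Line × B.Line := fun e => (P.headLine e, P.tailLine e)
  let c' : Γ'.E → B.Line × B.Line := fun e => (P'.headLine e, P'.tailLine e)
  have hc : Function.Injective c := fun e f h => P.headLine_injective (congrArg Prod.fst h)
  have hc' : Function.Injective c' := fun e f h => P'.headLine_injective (congrArg Prod.fst h)
  have hE : Set.range c = Set.range c' := by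
    ext ⟨x, y⟩
    simp only [Set.mem_range, c, c', Prod.mk.injEq]
    rw [P.exists_line_iff, P'.exists_line_iff]
  have hV : Set.range P.vertex = Set.range P'.vertex := by rw [P.range_vertex, P'.range_vertex]
  have key := apply_equivOfRangeEq c c' hc hc' hE
  have keyV := apply_equivOfRangeEq _ _ P.vertex_injective P'.vertex_injective hV
  exact
  { onE := equivOfRangeEq c c' hc hc' hE
    onV := equivOfRangeEq _ _ P.vertex_injective P'.vertex_injective hV
    head_eq := fun e => by
      apply Option.map_injective P'.vertex_injective
      have h := congrArg Prod.fst (key e)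
      simp only [c, c'] at h
      rw [← P'.head_eq, h, P.head_eq, Option.map_map]
      congr 1
      funext v
      exact (keyV v).symm
    tail_eq := fun e => by
      apply Option.map_injective P'.vertex_injective
      have h := congrArg Prod.snd (key e)
      simp only [c, c'] at h
      rw [← P'.tail_eq, h, P.tail_eq, Option.map_map]
      congr 1
      funext v
      exact (keyV v).symm }

theorem tail_eq_none_iff (P : B.Gluing A M Γ) (e : Γ.E) :
    Γ.tail e = none ↔ P.headLine e = P.tailLine e ∧ P.headLine e ∈ B.freeIn A M := by
  have h1 : Γ.tail e = none ↔ B.tail (P.tailLine e) = none := by rw [P.tail_eq]; simp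
  rw [h1]
  constructor
  · intro h
    rcases P.line_cases e with h' | h'
    · have := (P.glued _ _ h').2.2.2
      have h2 := B.attached (P.tailLine e)
      simp [*] at h2
    · exact ⟨h'.1, h'.2.1, h'.1 ▸ h, fun z => (h'.2.2 z).1⟩
  · rintro ⟨h, h'⟩
    exact h ▸ h'.2.1

theorem head_eq_none_iff (P : B.Gluing A M Γ) (e : Γ.E) :
    Γ.head e = none ↔ P.headLine e = P.tailLine e ∧ P.tailLine e ∈ B.freeOut A M := by
  have h1 : Γ.head e = none ↔ B.head (P.headLine e) = none := by rw [P.head_eq]; simp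
  rw [h1]
  constructor
  · intro h
    rcases P.line_cases e with h' | h'
    · have := (P.glued _ _ h').2.2.1
      have h2 := B.attached (P.headLine e)
      simp [*] at h2
    · rw [← h'.1]
      exact ⟨rfl, h'.2.1, h, fun z => (h'.2.2 z).2⟩
  · rintro ⟨h, h'⟩
    exact h ▸ h'.2.1

theorem range_headLine_incoming (P : B.Gluing A M Γ) :
    Set.range (fun e : Γ.Incoming => P.headLine e.1) = B.freeIn A M := by
  ext x
  constructor
  · rintro ⟨e, rfl⟩
    exact ((P.tail_eq_none_iff e.1).1 e.2).2
  · intro h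
    obtain ⟨e, rfl, he⟩ := (P.exists_line_iff x x).2 (.inr ⟨rfl, h.1,
      fun z => ⟨h.2.2 z, fun hz => by
        have := (P.glued _ _ hz).2.2.2
        have h2 := B.attached x
        simp [this, h.2.1] at h2⟩⟩)
    exact ⟨⟨e, (P.tail_eq_none_iff e).2 ⟨he.symm, h⟩⟩, rfl⟩

theorem range_tailLine_outgoing (P : B.Gluing A M Γ) :
    Set.range (fun e : Γ.Outgoing => P.tailLine e.1) = B.freeOut A M := by
  ext x
  constructor
  · rintro ⟨e, rfl⟩
    exact ((P.head_eq_none_iff e.1).1 e.2).2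
  · intro h
    obtain ⟨e, he, rfl⟩ := (P.exists_line_iff x x).2 (.inr ⟨rfl, h.1, fun z => ⟨fun hz => by
      have := (P.glued _ _ hz).2.2.1
      have h2 := B.attached x
      simp [this, h.2.1] at h2, h.2.2 z⟩⟩)
    exact ⟨⟨e, (P.head_eq_none_iff e).2 ⟨he, h⟩⟩, rfl⟩

open HWGraph in
/-- If `Γ₂` and `Γ₁` are glued from disjoint parts, then their composite along `m` is glued from the
union of these parts, with the pairs in `m` as additional glued pairs. -/
def comp (P₂ : B.Gluing A₂ M₂ Γ₂) (P₁ : B.Gluing A₁ M₁ Γ₁)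
    (hd : Disjoint (B.ends A₂) (B.ends A₁)) (m : HWGraph.Matching Γ₂.Incoming Γ₁.Outgoing) :
    B.Gluing (A₂ ∪ A₁)
      (M₂ ∪ M₁ ∪ (fun p : Γ₂.Incoming × Γ₁.Outgoing =>
        (P₂.headLine p.1.1, P₁.tailLine p.2.1)) '' (m.1 : Set _)) (Γ₂.comp Γ₁ m) where
  headLine := Sum.elim (fun e => P₂.headLine e.1)
    (Sum.elim (fun e => P₁.headLine e.1) fun p => P₂.headLine p.1.1.1)
  tailLine := Sum.elim (fun e => P₂.tailLine e.1)
    (Sum.elim (fun e => P₁.tailLine e.1) fun p => P₁.tailLine p.1.2.1)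
  vertex := Sum.elim P₂.vertex P₁.vertex
  headLine_injective := by
    have hA := Set.disjoint_left.1 (disjoint_of_ends hd)
    rintro (e | e | p) (f | f | q) h <;> simp only [Sum.elim_inl, Sum.elim_inr] at h
    · rw [Subtype.ext (P₂.headLine_injective h)]
    · exact (hA (P₂.headLine_mem e.1) (h ▸ P₁.headLine_mem _)).elim
    · exact (e.2 _ q.2 (P₂.headLine_injective h).symm).elim
    · exact (hA (P₂.headLine_mem f.1) (h ▸ P₁.headLine_mem _)).elim
    · rw [Subtype.ext (P₁.headLine_injective h)]
    · exact (hA (P₂.headLine_mem q.1.1.1) (h ▸ P₁.headLine_mem _)).elim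
    · exact (f.2 _ p.2 (P₂.headLine_injective h)).elim
    · exact (hA (P₂.headLine_mem p.1.1.1) (h ▸ P₁.headLine_mem _)).elim
    · rw [Subtype.ext (m.2 _ p.2 _ q.2 (.inl (Subtype.ext (P₂.headLine_injective h))))]
  tailLine_injective := by
    have hA := Set.disjoint_left.1 (disjoint_of_ends hd)
    rintro (e | e | p) (f | f | q) h <;> simp only [Sum.elim_inl, Sum.elim_inr] at h
    · rw [Subtype.ext (P₂.tailLine_injective h)]
    · exact (hA (P₂.tailLine_mem e.1) (h ▸ P₁.tailLine_mem _)).elim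
    · exact (hA (P₂.tailLine_mem e.1) (h ▸ P₁.tailLine_mem _)).elim
    · exact (hA (P₂.tailLine_mem f.1) (h ▸ P₁.tailLine_mem _)).elim
    · rw [Subtype.ext (P₁.tailLine_injective h)]
    · exact (e.2 _ q.2 (P₁.tailLine_injective h).symm).elim
    · exact (hA (P₂.tailLine_mem f.1) (h ▸ P₁.tailLine_mem _)).elim
    · exact (f.2 _ p.2 (P₁.tailLine_injective h)).elim
    · rw [Subtype.ext (m.2 _ p.2 _ q.2 (.inr (Subtype.ext (P₁.tailLine_injective h))))]
  vertex_injective := by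
    refine P₂.vertex_injective.sumElim P₁.vertex_injective fun v w h => ?_
    exact Set.disjoint_left.1 hd (P₂.vertex_mem_ends v) (h ▸ P₁.vertex_mem_ends w)
  head_eq := by
    rintro (e | e | p)
    · exact (P₂.head_eq e.1).trans (by simp [HWGraph.comp, compHead, Function.comp_def])
    · exact (P₁.head_eq e.1).trans (by simp [HWGraph.comp, compHead, Function.comp_def])
    · exact (P₂.head_eq p.1.1.1).trans (by simp [HWGraph.comp, compHead, Function.comp_def])
  tail_eq := by
    rintro (e | e | p)
    · exact (P₂.tail_eq e.1).trans (by simp [HWGraph.comp, compTail, Function.comp_def])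
    · exact (P₁.tail_eq e.1).trans (by simp [HWGraph.comp, compTail, Function.comp_def])
    · exact (P₁.tail_eq p.1.2.1).trans (by simp [HWGraph.comp, compTail, Function.comp_def])
  glued := by
    rintro x y ((h | h) | ⟨p, -, hp⟩)
    · obtain ⟨h1, h2, h3⟩ := P₂.glued _ _ h
      exact ⟨.inl h1, .inl h2, h3⟩
    · obtain ⟨h1, h2, h3⟩ := P₁.glued _ _ h
      exact ⟨.inr h1, .inr h2, h3⟩
    · obtain ⟨rfl, rfl⟩ := Prod.mk.inj hp
      exact ⟨.inl (P₂.headLine_mem _), .inr (P₁.tailLine_mem _),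
        ((P₂.tail_eq_none_iff _).1 p.1.2).2.2.1, ((P₁.head_eq_none_iff _).1 p.2.2).2.2.1⟩
  exists_line_iff := by
    have hA := Set.disjoint_left.1 (disjoint_of_ends hd)
    intro x y
    constructor
    · rintro ⟨(e | e | p), rfl, rfl⟩ <;> simp only [Sum.elim_inl, Sum.elim_inr]
      · rcases P₂.line_cases e.1 with h | ⟨h1, h2, h3⟩
        · exact .inl (.inl (.inl h))
        · refine .inr ⟨h1, .inl h2, fun z => ⟨?_, ?_⟩⟩
          · rintro ((h | h) | ⟨p, hp, h⟩)
            · exact (h3 z).1 h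
            · exact hA h2 (P₁.glued _ _ h).1
            · exact e.2 p hp (P₂.headLine_injective (congrArg Prod.fst h))
          · rintro ((h | h) | ⟨p, hp, h⟩)
            · exact (h3 z).2 h
            · exact hA h2 (P₁.glued _ _ h).2.1
            · exact hA h2 ((Prod.mk.inj h).2 ▸ P₁.tailLine_mem p.2.1)
      · rcases P₁.line_cases e.1 with h | ⟨h1, h2, h3⟩
        · exact .inl (.inl (.inr h))
        · refine .inr ⟨h1, .inr h2, fun z => ⟨?_, ?_⟩⟩
          · rintro ((h | h) | ⟨p, hp, h⟩)
            · exact hA (P₂.glued _ _ h).1 h2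
            · exact (h3 z).1 h
            · exact hA ((Prod.mk.inj h).1 ▸ P₂.headLine_mem p.1.1) h2
          · rintro ((h | h) | ⟨p, hp, h⟩)
            · exact hA (P₂.glued _ _ h).2.1 h2
            · exact (h3 z).2 h
            · exact e.2 p hp (P₁.tailLine_injective ((congrArg Prod.snd h).trans h1))
      · exact .inl (.inr ⟨p.1, p.2, rfl⟩)
    · have hunm : ∀ e : Γ₂.E, ∀ p ∈ m.1, p.1.1 = e → P₂.headLine e = P₂.tailLine e ∧
          P₂.headLine e ∈ B.freeIn A₂ M₂ := by
        rintro _ p hp rfl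
        exact (P₂.tail_eq_none_iff _).1 p.1.2
      have hunm' : ∀ e : Γ₁.E, ∀ p ∈ m.1, p.2.1 = e → P₁.headLine e = P₁.tailLine e ∧
          P₁.tailLine e ∈ B.freeOut A₁ M₁ := by
        rintro _ p hp rfl
        exact (P₁.head_eq_none_iff _).1 p.2.2
      rintro (((h | h) | ⟨p, hp, h⟩) | ⟨rfl, (h | h), hz⟩)
      · obtain ⟨e, rfl, rfl⟩ := (P₂.exists_line_iff x y).2 (.inl h)
        exact ⟨.inl ⟨e, fun p hp hpe => (hunm e p hp hpe).2.2.2 _ h⟩, rfl, rfl⟩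
      · obtain ⟨e, rfl, rfl⟩ := (P₁.exists_line_iff x y).2 (.inl h)
        exact ⟨.inr (.inl ⟨e, fun p hp hpe => (hunm' e p hp hpe).2.2.2 _ h⟩), rfl, rfl⟩
      · obtain ⟨rfl, rfl⟩ := Prod.mk.inj h
        exact ⟨.inr (.inr ⟨p, hp⟩), rfl, rfl⟩
      · obtain ⟨e, rfl, he⟩ := (P₂.exists_line_iff x x).2 (.inr ⟨rfl, h, fun z =>
          ⟨fun h' => (hz z).1 (.inl (.inl h')), fun h' => (hz z).2 (.inl (.inl h'))⟩⟩)
        refine ⟨.inl ⟨e, ?_⟩, rfl, he⟩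
        rintro p hp rfl
        exact (hz _).1 (.inr ⟨p, hp, rfl⟩)
      · obtain ⟨e, he, rfl⟩ := (P₁.exists_line_iff x x).2 (.inr ⟨rfl, h, fun z =>
          ⟨fun h' => (hz z).1 (.inl (.inr h')), fun h' => (hz z).2 (.inl (.inr h'))⟩⟩)
        refine ⟨.inr (.inl ⟨e, ?_⟩), he, rfl⟩
        rintro p hp rfl
        exact (hz _).2 (.inr ⟨p, hp, rfl⟩)

/-- The restriction to the lines of a set `D` that does not separate glued lines. -/
def restrict (P : B.Gluing A M Γ) (D : Set B.Line) (hDA : D ⊆ A)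
    (hD : ∀ p ∈ M, p.1 ∈ D ↔ p.2 ∈ D) :
    B.Gluing D {p ∈ M | p.1 ∈ D} (Γ.restrict {e | P.headLine e ∈ D}) where
  headLine e := P.headLine e.1
  tailLine e := P.tailLine e.1
  vertex v := P.vertex v.1
  headLine_injective := P.headLine_injective.comp Subtype.val_injective
  tailLine_injective := P.tailLine_injective.comp Subtype.val_injective
  vertex_injective := P.vertex_injective.comp Subtype.val_injective
  head_eq e := by
    rw [P.head_eq]
    simp only [HWGraph.restrict]
    rw [Option.map_pmap]
    simp [Option.pmap_eq_map]
  tail_eq e := by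
    rw [P.tail_eq]
    simp only [HWGraph.restrict]
    rw [Option.map_pmap]
    simp [Option.pmap_eq_map]
  glued := by
    rintro x y ⟨h, hx⟩
    exact ⟨hx, (hD _ h).1 hx, (P.glued _ _ h).2.2⟩
  exists_line_iff x y := by
    constructor
    · rintro ⟨⟨e, he⟩, rfl, rfl⟩
      rcases P.line_cases e with h | ⟨h1, h2, h3⟩
      · exact .inl ⟨h, he⟩
      · exact .inr ⟨h1, he, fun z => ⟨fun h => (h3 z).1 h.1, fun h => (h3 z).2 h.1⟩⟩
    · rintro (⟨h, hx⟩ | ⟨rfl, hx, h⟩)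
      · obtain ⟨e, rfl, rfl⟩ := (P.exists_line_iff x y).2 (.inl h)
        exact ⟨⟨e, hx⟩, rfl, rfl⟩
      · obtain ⟨e, rfl, he⟩ := (P.exists_line_iff x x).2 (.inr ⟨rfl, hDA hx, fun z =>
          ⟨fun h' => (h z).1 ⟨h', hx⟩, fun h' => (h z).2 ⟨h', (hD _ h').2 hx⟩⟩⟩)
        exact ⟨⟨e, hx⟩, rfl, he⟩

end Gluing

end LineSystem

/-! ### Product and coproduct in terms of gluing -/

/-- The matchings of two sets `X` and `Y`, as sets of pairs. -/
def LineSystem.pairings {C : Type} (X Y : Set C) : Set (Set (C × C)) :=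
  {N | (∀ p ∈ N, p.1 ∈ X ∧ p.2 ∈ Y) ∧ ∀ p ∈ N, ∀ q ∈ N, p.1 = q.1 ∨ p.2 = q.2 → p = q}

namespace LineSystem

/-- A sum over matchings can be taken over pairings of the sets that index the matched lines. -/
theorem sum_matching {R : Type*} [AddCommMonoid R] {C α β : Type} [Finite C] [Finite α] [Finite β]
    (f : α → C) (g : β → C) (hf : Function.Injective f) (hg : Function.Injective g)
    {X Y : Set C} (hX : Set.range f = X) (hY : Set.range g = Y) (F : Set (C × C) → R) :
    ∑ m : HWGraph.Matching α β, F (Prod.map f g '' (m.1 : Set (α × β))) =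
      ∑ N ∈ (pairings X Y).toFinite.toFinset, F N := by
  subst hX hY
  have hfg := hf.prodMap hg
  refine Finset.sum_bij (fun m _ => Prod.map f g '' (m.1 : Set (α × β))) ?_ ?_ ?_ fun _ _ => rfl
  · intro m _
    rw [Set.Finite.mem_toFinset]
    refine ⟨?_, ?_⟩
    · rintro _ ⟨p, -, rfl⟩
      exact ⟨⟨_, rfl⟩, ⟨_, rfl⟩⟩
    · rintro _ ⟨p, hp, rfl⟩ _ ⟨q, hq, rfl⟩ h
      rw [m.2 p hp q hq (h.imp (fun h => hf h) fun h => hg h)]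
  · intro m _ m' _ h
    exact Subtype.ext (Finset.coe_injective (hfg.image_injective h))
  · intro N hN
    rw [Set.Finite.mem_toFinset] at hN
    let S : Set (α × β) := Prod.map f g ⁻¹' N
    refine ⟨⟨S.toFinite.toFinset, ?_⟩, Finset.mem_univ _, ?_⟩
    · intro p hp q hq h
      rw [Set.Finite.mem_toFinset] at hp hq
      exact hfg (hN.2 _ hp _ hq (h.imp (congrArg f) (congrArg g)))
    · simp only [Set.Finite.coe_toFinset, S]
      refine Set.image_preimage_eq_of_subset ?_
      rintro ⟨x, y⟩ h
      obtain ⟨⟨a, rfl⟩, ⟨b, rfl⟩⟩ := hN.1 _ h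
      exact ⟨(a, b), rfl⟩

variable (B : LineSystem)

/-- Some graph is obtained from the lines in `A` by gluing along `M`. -/
def Realizable (A : Set B.Line) (M : Set (B.Line × B.Line)) : Prop :=
  ∃ Γ, Nonempty (B.Gluing A M Γ)

open scoped Classical in
/-- The diagram obtained from the lines in `A` by gluing along `M`; the void diagram is a junk value
for data that are not realizable. -/
def diagram (A : Set B.Line) (M : Set (B.Line × B.Line)) : Diagram :=
  if h : B.Realizable A M then .mk h.choose else .void

variable {B} {A A₁ A₂ : Set B.Line} {M M₁ M₂ : Set (B.Line × B.Line)} {Γ Γ₁ Γ₂ : HWGraph}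

theorem Gluing.realizable (P : B.Gluing A M Γ) : B.Realizable A M := ⟨Γ, ⟨P⟩⟩

theorem Gluing.diagram_eq (P : B.Gluing A M Γ) : B.diagram A M = .mk Γ := by
  rw [diagram, dif_pos P.realizable]
  exact Diagram.mk_eq (P.realizable.choose_spec.some.iso P)

theorem Realizable.union (h₂ : B.Realizable A₂ M₂) (h₁ : B.Realizable A₁ M₁)
    (hd : Disjoint (B.ends A₂) (B.ends A₁)) {N : Set (B.Line × B.Line)}
    (hN : N ∈ pairings (B.freeIn A₂ M₂) (B.freeOut A₁ M₁)) :
    B.Realizable (A₂ ∪ A₁) (M₂ ∪ M₁ ∪ N) := by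
  obtain ⟨Γ₂, ⟨P₂⟩⟩ := h₂
  obtain ⟨Γ₁, ⟨P₁⟩⟩ := h₁
  let m : Set (Γ₂.Incoming × Γ₁.Outgoing) := {p | (P₂.headLine p.1.1, P₁.tailLine p.2.1) ∈ N}
  have hm : ∀ p ∈ m.toFinite.toFinset, ∀ q ∈ m.toFinite.toFinset,
      p.1 = q.1 ∨ p.2 = q.2 → p = q := by
    intro p hp q hq h
    rw [Set.Finite.mem_toFinset] at hp hq
    have := hN.2 _ hp _ hq (h.imp (fun h => by rw [h]) fun h => by rw [h])
    exact Prod.ext (Subtype.ext (P₂.headLine_injective (Prod.mk.inj this).1))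
      (Subtype.ext (P₁.tailLine_injective (Prod.mk.inj this).2))
  have P := P₂.comp P₁ hd ⟨_, hm⟩
  convert P.realizable
  ext ⟨x, y⟩
  constructor
  · intro h
    obtain ⟨hx, hy⟩ := hN.1 _ h
    rw [← P₂.range_headLine_incoming] at hx
    rw [← P₁.range_tailLine_outgoing] at hy
    obtain ⟨e, rfl⟩ := hx
    obtain ⟨f, rfl⟩ := hy
    exact ⟨(e, f), by simpa [m] using h, rfl⟩
  · rintro ⟨p, hp, h⟩
    rw [Set.Finite.coe_toFinset] at hp
    exact h ▸ hp

open DiagramAlg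

variable (K : Type*) [Field K]

/-- The product formula: the composites of two disjoint glued graphs are obtained by gluing along
one more matching. -/
theorem mulDiagram_diagram (h₂ : B.Realizable A₂ M₂) (h₁ : B.Realizable A₁ M₁)
    (hd : Disjoint (B.ends A₂) (B.ends A₁)) :
    mulDiagram K (B.diagram A₂ M₂) (B.diagram A₁ M₁) =
      ∑ N ∈ (pairings (B.freeIn A₂ M₂) (B.freeOut A₁ M₁)).toFinite.toFinset,
        of K (B.diagram (A₂ ∪ A₁) (M₂ ∪ M₁ ∪ N)) := by
  obtain ⟨Γ₂, ⟨P₂⟩⟩ := h₂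
  obtain ⟨Γ₁, ⟨P₁⟩⟩ := h₁
  rw [P₂.diagram_eq, P₁.diagram_eq]
  refine Eq.trans ?_ (sum_matching (fun e : Γ₂.Incoming => P₂.headLine e.1)
    (fun e : Γ₁.Outgoing => P₁.tailLine e.1)
    (P₂.headLine_injective.comp Subtype.val_injective)
    (P₁.tailLine_injective.comp Subtype.val_injective)
    P₂.range_headLine_incoming P₁.range_tailLine_outgoing _)
  exact Finset.sum_congr rfl fun m _ => by rw [← (P₂.comp P₁ hd m).diagram_eq]; rfl

/-- The subsets of `A` that do not separate lines glued by `M`. -/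
def saturated (A : Set B.Line) (M : Set (B.Line × B.Line)) : Set (Set B.Line) :=
  {D | D ⊆ A ∧ ∀ p ∈ M, p.1 ∈ D ↔ p.2 ∈ D}

theorem Realizable.restrict (h : B.Realizable A M) {D : Set B.Line} (hD : D ∈ saturated A M) :
    B.Realizable D {p ∈ M | p.1 ∈ D} := by
  obtain ⟨Γ, ⟨P⟩⟩ := h
  exact (P.restrict D hD.1 hD.2).realizable

theorem Realizable.diff_mem_saturated (h : B.Realizable A M) {D : Set B.Line}
    (hD : D ∈ saturated A M) : A \ D ∈ saturated A M := by
  obtain ⟨Γ, ⟨P⟩⟩ := h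
  refine ⟨Set.sdiff_subset, fun p hp => ?_⟩
  have := P.glued _ _ hp
  simp [hD.2 p hp, this.1, this.2.1]

/-- The coproduct formula: the sets of lines of a glued graph correspond to the saturated subsets
of `A`. -/
theorem comulDiagram_diagram (h : B.Realizable A M) :
    comulDiagram K (B.diagram A M) = ∑ D ∈ (saturated A M).toFinite.toFinset,
      of K (B.diagram D {p ∈ M | p.1 ∈ D}) ⊗ₜ[K]
        of K (B.diagram (A \ D) {p ∈ M | p.1 ∈ A \ D}) := by
  have hsat := fun D => h.diff_mem_saturated (D := D)
  obtain ⟨Γ, ⟨P⟩⟩ := h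
  rw [P.diagram_eq]
  symm
  refine Finset.sum_bij (fun D _ => {e | P.headLine e ∈ D}) (fun _ _ => Finset.mem_univ _) ?_ ?_ ?_
  · -- a saturated set is determined by the heads of the lines it contains
    have key : ∀ D ∈ saturated A M, ∀ D' ∈ saturated A M,
        {e | P.headLine e ∈ D} = {e | P.headLine e ∈ D'} → D ⊆ D' := by
      intro D hD D' hD' h x hx
      by_cases h' : ∃ z, (z, x) ∈ M
      · obtain ⟨z, hz⟩ := h'
        obtain ⟨e, rfl, rfl⟩ := (P.exists_line_iff z x).2 (.inl hz)
        rw [← hD'.2 _ hz]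
        exact (Set.ext_iff.1 h e).1 ((hD.2 _ hz).2 hx)
      · push Not at h'
        obtain ⟨e, rfl⟩ := P.exists_headLine (hD.1 hx) h'
        exact (Set.ext_iff.1 h e).1 hx
    intro D hD D' hD' h
    rw [Set.Finite.mem_toFinset] at hD hD'
    exact (key D hD D' hD' h).antisymm (key D' hD' D hD h.symm)
  · intro L _
    have hsub : P.headLine '' L ∪ P.tailLine '' L ⊆ A := by
      rintro _ (⟨e, -, rfl⟩ | ⟨e, -, rfl⟩)
      · exact P.headLine_mem e
      · exact P.tailLine_mem e
    have hht : ∀ e f, P.headLine e = P.tailLine f → e = f := by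
      intro e f hef
      rcases P.line_cases e with h | h
      · rcases P.line_cases f with h' | h'
        · have h1 := (P.glued _ _ h).2.2.1
          have h2 := (P.glued _ _ h').2.2.2
          rw [← hef] at h2
          have := B.attached (P.headLine e)
          simp [h1, h2] at this
        · exact P.headLine_injective (hef.trans h'.1.symm)
      · exact P.tailLine_injective (h.1.symm.trans hef)
    refine ⟨P.headLine '' L ∪ P.tailLine '' L, ?_, ?_⟩
    · rw [Set.Finite.mem_toFinset]
      refine ⟨hsub, ?_⟩
      rintro ⟨x, y⟩ hp
      obtain ⟨e, rfl, rfl⟩ := (P.exists_line_iff x y).2 (.inl hp)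
      have h1 : ∀ f, P.headLine f = P.headLine e ↔ f = e := fun f => P.headLine_injective.eq_iff
      have h2 : ∀ f, P.tailLine f = P.tailLine e ↔ f = e := fun f => P.tailLine_injective.eq_iff
      have h3 : ∀ f, P.tailLine f = P.headLine e → f = e := fun f hf => (hht _ _ hf.symm).symm
      have h4 : ∀ f, P.headLine f = P.tailLine e → f = e := fun f hf => hht _ _ hf
      simp only [Set.mem_union, Set.mem_image, h1, h2, exists_eq_right]
      constructor
      · rintro (h | ⟨f, hf, h⟩)
        · exact .inr h
        · exact .inr (h3 f h ▸ hf)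
      · rintro (⟨f, hf, h⟩ | h)
        · exact .inl (h4 f h ▸ hf)
        · exact .inl h
    · ext e
      simp only [Set.mem_union, Set.mem_image, Set.mem_ofPred_eq, P.headLine_injective.eq_iff,
        exists_eq_right]
      refine ⟨?_, .inl⟩
      rintro (h | ⟨f, hf, h⟩)
      · exact h
      · exact (hht _ _ h.symm) ▸ hf
  · intro D hD
    rw [Set.Finite.mem_toFinset] at hD
    have hc : {e | P.headLine e ∈ D}ᶜ = {e | P.headLine e ∈ A \ D} := by
      ext e
      simp [P.headLine_mem]
    rw [hc, (P.restrict D hD.1 hD.2).diagram_eq,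
      (P.restrict _ (hsat D hD).1 (hsat D hD).2).diagram_eq]

end LineSystem

namespace DiagramAlg
variable (K : Type*) [Field K]

theorem mul_of (D D' : Diagram) : mul K (of K D) (of K D') = mulDiagram K D D' := by
  simp [mul, of]

theorem comul_of (D : Diagram) : comul K (of K D) = comulDiagram K D := by
  simp [comul, of]

theorem antipode_of (D : Diagram) : antipode K (of K D) = antipodeDiagram K D := by
  simp [antipode, of]

end DiagramAlg

namespace HWGraph

/-- The lines of a graph as a supply of lines. -/
def lineSystem (Γ : HWGraph) : LineSystem where
  Line := Γ.E
  Vertex := Γ.V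
  finite := inferInstance
  head := Γ.head
  tail := Γ.tail
  attached := Γ.attached

/-- A graph embedded into the ambient lines is presented without any gluing. -/
def gluingOfEmbedding {B : LineSystem} (Γ : HWGraph) (f : Γ.E → B.Line) (g : Γ.V → B.Vertex)
    (hf : Function.Injective f) (hg : Function.Injective g)
    (hh : ∀ e, B.head (f e) = (Γ.head e).map g) (ht : ∀ e, B.tail (f e) = (Γ.tail e).map g)
    {A : Set B.Line} (hA : Set.range f = A) : B.Gluing A ∅ Γ where
  headLine := f
  tailLine := f
  vertex := g
  headLine_injective := hf
  tailLine_injective := hf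
  vertex_injective := hg
  head_eq := hh
  tail_eq := ht
  glued := by simp
  exists_line_iff x y := by
    subst hA
    constructor
    · rintro ⟨e, rfl, rfl⟩
      exact .inr ⟨rfl, ⟨e, rfl⟩, fun _ => ⟨id, id⟩⟩
    · rintro (h | ⟨rfl, ⟨e, rfl⟩, -⟩)
      · exact h.elim
      · exact ⟨e, rfl, rfl⟩

end HWGraph

/-! ### Associativity, and compatibility of product and coproduct -/

namespace LineSystem

/-- The disjoint union of two supplies of lines. -/
def sum (B B' : LineSystem) : LineSystem where
  Line := B.Line ⊕ B'.Line
  Vertex := B.Vertex ⊕ B'.Vertex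
  finite := inferInstance
  head := Sum.elim (fun x => (B.head x).map Sum.inl) fun x => (B'.head x).map Sum.inr
  tail := Sum.elim (fun x => (B.tail x).map Sum.inl) fun x => (B'.tail x).map Sum.inr
  attached := by
    rintro (x | x)
    · simpa using B.attached x
    · simpa using B'.attached x

variable {B : LineSystem} {A A₁ A₂ A₃ : Set B.Line}

theorem ends_union : B.ends (A₂ ∪ A₁) = B.ends A₂ ∪ B.ends A₁ := by
  ext v
  simp only [ends, Set.mem_union, Set.mem_ofPred_eq]
  constructor
  · rintro ⟨x, h | h, h'⟩
    · exact .inl ⟨x, h, h'⟩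
    · exact .inr ⟨x, h, h'⟩
  · rintro (⟨x, h, h'⟩ | ⟨x, h, h'⟩)
    · exact ⟨x, .inl h, h'⟩
    · exact ⟨x, .inr h, h'⟩

theorem ends_mono (h : A₂ ⊆ A₁) : B.ends A₂ ⊆ B.ends A₁ :=
  fun _ ⟨x, hx, h'⟩ => ⟨x, h hx, h'⟩

theorem ends_range_subset {Γ : HWGraph} (f : Γ.E → B.Line) (g : Γ.V → B.Vertex)
    (hh : ∀ e, B.head (f e) = (Γ.head e).map g) (ht : ∀ e, B.tail (f e) = (Γ.tail e).map g) :
    B.ends (Set.range f) ⊆ Set.range g := by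
  rintro v ⟨_, ⟨e, rfl⟩, h | h⟩
  · rw [hh, Option.map_eq_some_iff] at h
    obtain ⟨w, -, rfl⟩ := h
    exact ⟨w, rfl⟩
  · rw [ht, Option.map_eq_some_iff] at h
    obtain ⟨w, -, rfl⟩ := h
    exact ⟨w, rfl⟩

/-- The two ways to glue three parts `A₃`, `A₂`, `A₁` in two steps range over the same sets of
glued pairs: both are sums over matchings of the incoming lines of an earlier part with the outgoing
lines of a later one. -/
theorem sum_pairings_assoc {R : Type*} [AddCommMonoid R] (h₃₂ : Disjoint A₃ A₂)
    (h₂₁ : Disjoint A₂ A₁) (F : Set (B.Line × B.Line) → R) :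
    ∑ N ∈ (pairings (B.freeIn A₃ ∅) (B.freeOut A₂ ∅)).toFinite.toFinset,
      ∑ N' ∈ (pairings (B.freeIn (A₃ ∪ A₂) N) (B.freeOut A₁ ∅)).toFinite.toFinset, F (N ∪ N') =
    ∑ N ∈ (pairings (B.freeIn A₂ ∅) (B.freeOut A₁ ∅)).toFinite.toFinset,
      ∑ N' ∈ (pairings (B.freeIn A₃ ∅) (B.freeOut (A₂ ∪ A₁) N)).toFinite.toFinset,
        F (N ∪ N') := by
  rw [Finset.sum_sigma', Finset.sum_sigma']
  rw [Set.disjoint_left] at h₃₂ h₂₁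
  -- the pairs between `A₃` and `A₁` are glued in the second step on both sides
  refine Finset.sum_bij'
    (fun s _ => ⟨{p ∈ s.2 | p.1 ∈ A₂}, s.1 ∪ {p ∈ s.2 | p.1 ∈ A₃}⟩)
    (fun s _ => ⟨{p ∈ s.2 | p.2 ∈ A₂}, s.1 ∪ {p ∈ s.2 | p.2 ∈ A₁}⟩) ?_ ?_ ?_ ?_ ?_
  · rintro ⟨N, N'⟩ h
    simp only [Finset.mem_sigma, Set.Finite.mem_toFinset, pairings, freeIn, freeOut,
      Set.mem_ofPred_eq, Set.mem_union, Set.mem_empty_iff_false, not_false_eq_true, implies_true,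
      and_true] at h ⊢
    refine ⟨⟨fun p hp => ?_, fun p hp q hq hpq => ?_⟩, fun p hp => ?_, fun p hp q hq hpq => ?_⟩ <;>
      grind
  · rintro ⟨N, N'⟩ h
    simp only [Finset.mem_sigma, Set.Finite.mem_toFinset, pairings, freeIn, freeOut,
      Set.mem_ofPred_eq, Set.mem_union, Set.mem_empty_iff_false, not_false_eq_true, implies_true,
      and_true] at h ⊢
    refine ⟨⟨fun p hp => ?_, fun p hp q hq hpq => ?_⟩, fun p hp => ?_, fun p hp q hq hpq => ?_⟩ <;>
      grind
  · rintro ⟨N, N'⟩ h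
    simp only [Finset.mem_sigma, Set.Finite.mem_toFinset, pairings, freeIn, freeOut,
      Set.mem_ofPred_eq, Set.mem_union, Set.mem_empty_iff_false, not_false_eq_true, implies_true,
      and_true] at h
    simp only [Sigma.mk.injEq, heq_eq_eq, Set.ext_iff, Set.mem_ofPred_eq, Set.mem_union]
    grind
  · rintro ⟨N, N'⟩ h
    simp only [Finset.mem_sigma, Set.Finite.mem_toFinset, pairings, freeIn, freeOut,
      Set.mem_ofPred_eq, Set.mem_union, Set.mem_empty_iff_false, not_false_eq_true, implies_true,
      and_true] at h
    simp only [Sigma.mk.injEq, heq_eq_eq, Set.ext_iff, Set.mem_ofPred_eq, Set.mem_union]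
    grind
  · rintro ⟨N, N'⟩ h
    simp only [Finset.mem_sigma, Set.Finite.mem_toFinset, pairings, freeIn, freeOut,
      Set.mem_ofPred_eq, Set.mem_union, Set.mem_empty_iff_false, not_false_eq_true, implies_true,
      and_true] at h
    congr 1
    simp only [Set.ext_iff, Set.mem_ofPred_eq, Set.mem_union]
    grind

/-- Gluing two parts and then distributing the lines, each glued pair as one line, amounts to
distributing the lines of both parts first and then gluing on each side. -/
theorem sum_pairings_saturated {R : Type*} [AddCommMonoid R] (h₂₁ : Disjoint A₂ A₁)
    (F : Set B.Line → Set (B.Line × B.Line) → Set B.Line → Set (B.Line × B.Line) → R) :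
    ∑ N ∈ (pairings (B.freeIn A₂ ∅) (B.freeOut A₁ ∅)).toFinite.toFinset,
      ∑ D ∈ (saturated (A₂ ∪ A₁) N).toFinite.toFinset,
        F D {p ∈ N | p.1 ∈ D} ((A₂ ∪ A₁) \ D) {p ∈ N | p.1 ∈ (A₂ ∪ A₁) \ D} =
    ∑ D₂ ∈ (saturated A₂ ∅).toFinite.toFinset, ∑ D₁ ∈ (saturated A₁ ∅).toFinite.toFinset,
      ∑ N ∈ (pairings (B.freeIn D₂ ∅) (B.freeOut D₁ ∅)).toFinite.toFinset,
        ∑ N' ∈ (pairings (B.freeIn (A₂ \ D₂) ∅) (B.freeOut (A₁ \ D₁) ∅)).toFinite.toFinset,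
          F (D₂ ∪ D₁) N (A₂ \ D₂ ∪ A₁ \ D₁) N' := by
  simp only [Finset.sum_sigma']
  rw [Set.disjoint_left] at h₂₁
  refine Finset.sum_bij'
    (fun s _ => ⟨s.2 ∩ A₂, s.2 ∩ A₁, {p ∈ s.1 | p.1 ∈ s.2}, {p ∈ s.1 | p.1 ∉ s.2}⟩)
    (fun s _ => ⟨s.2.2.1 ∪ s.2.2.2, s.1 ∪ s.2.1⟩) ?_ ?_ ?_ ?_ ?_
  · rintro ⟨N, D⟩ h
    simp only [Finset.mem_sigma, Set.Finite.mem_toFinset, pairings, freeIn, freeOut, saturated,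
      Set.mem_ofPred_eq, Set.mem_union, Set.mem_empty_iff_false, not_false_eq_true,
      implies_true, and_true, Set.subset_def, Set.mem_inter_iff,
      Set.mem_sdiff] at h ⊢
    refine ⟨?_, ?_, ⟨fun p hp => ?_, fun p hp q hq hpq => ?_⟩,
      fun p hp => ?_, fun p hp q hq hpq => ?_⟩ <;> grind
  · rintro ⟨D₂, D₁, N, N'⟩ h
    simp only [Finset.mem_sigma, Set.Finite.mem_toFinset, pairings, freeIn, freeOut, saturated,
      Set.mem_ofPred_eq, Set.mem_union, Set.mem_empty_iff_false, not_false_eq_true,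
      implies_true, and_true, Set.subset_def,
      Set.mem_sdiff] at h ⊢
    refine ⟨⟨fun p hp => ?_, fun p hp q hq hpq => ?_⟩, fun x hx => ?_, fun p hp => ?_⟩ <;> grind
  · rintro ⟨N, D⟩ h
    simp only [Finset.mem_sigma, Set.Finite.mem_toFinset, pairings, freeIn, freeOut, saturated,
      Set.mem_ofPred_eq, Set.mem_union, Set.mem_empty_iff_false, not_false_eq_true,
      implies_true, and_true, Set.subset_def] at h
    simp only [Sigma.mk.injEq, heq_eq_eq, Set.ext_iff, Set.mem_ofPred_eq, Set.mem_union,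
      Set.mem_inter_iff]
    grind
  · rintro ⟨D₂, D₁, N, N'⟩ h
    simp only [Finset.mem_sigma, Set.Finite.mem_toFinset, pairings, freeIn, freeOut, saturated,
      Set.mem_ofPred_eq, Set.mem_empty_iff_false, not_false_eq_true,
      implies_true, and_true, Set.subset_def,
      Set.mem_sdiff] at h
    simp only [Sigma.mk.injEq, heq_eq_eq, Set.ext_iff, Set.mem_ofPred_eq, Set.mem_union,
      Set.mem_inter_iff]
    grind
  · rintro ⟨N, D⟩ h
    simp only [Finset.mem_sigma, Set.Finite.mem_toFinset, pairings, freeIn, freeOut, saturated,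
      Set.mem_ofPred_eq, Set.mem_union, Set.mem_empty_iff_false, not_false_eq_true,
      implies_true, and_true, Set.subset_def] at h
    congr 1 <;> simp only [Set.ext_iff, Set.mem_ofPred_eq, Set.mem_union, Set.mem_inter_iff,
      Set.mem_sdiff] <;> grind

end LineSystem

namespace HWGraph

/-- Three graphs can be realized by disjoint sets of lines in one supply. -/
theorem exists_disjoint_triple (Γ₃ Γ₂ Γ₁ : HWGraph) :
    ∃ (B : LineSystem) (A₃ A₂ A₁ : Set B.Line), Nonempty (B.Gluing A₃ ∅ Γ₃) ∧
      Nonempty (B.Gluing A₂ ∅ Γ₂) ∧ Nonempty (B.Gluing A₁ ∅ Γ₁) ∧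
      Disjoint (B.ends A₃) (B.ends A₂) ∧ Disjoint (B.ends A₂) (B.ends A₁) ∧
      Disjoint (B.ends A₃) (B.ends A₁) := by
  let B := Γ₃.lineSystem.sum (Γ₂.lineSystem.sum Γ₁.lineSystem)
  let f₃ : Γ₃.E → B.Line := Sum.inl
  let f₂ : Γ₂.E → B.Line := Sum.inr ∘ Sum.inl
  let f₁ : Γ₁.E → B.Line := Sum.inr ∘ Sum.inr
  let g₃ : Γ₃.V → B.Vertex := Sum.inl
  let g₂ : Γ₂.V → B.Vertex := Sum.inr ∘ Sum.inl
  let g₁ : Γ₁.V → B.Vertex := Sum.inr ∘ Sum.inr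
  have hh₃ : ∀ e, B.head (f₃ e) = (Γ₃.head e).map g₃ := fun e => rfl
  have ht₃ : ∀ e, B.tail (f₃ e) = (Γ₃.tail e).map g₃ := fun e => rfl
  have hh₂ : ∀ e, B.head (f₂ e) = (Γ₂.head e).map g₂ := fun e => Option.map_map _ _ _
  have ht₂ : ∀ e, B.tail (f₂ e) = (Γ₂.tail e).map g₂ := fun e => Option.map_map _ _ _
  have hh₁ : ∀ e, B.head (f₁ e) = (Γ₁.head e).map g₁ := fun e => Option.map_map _ _ _
  have ht₁ : ∀ e, B.tail (f₁ e) = (Γ₁.tail e).map g₁ := fun e => Option.map_map _ _ _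
  refine ⟨B, _, _, _, ⟨Γ₃.gluingOfEmbedding f₃ g₃ Sum.inl_injective Sum.inl_injective hh₃ ht₃ rfl⟩,
    ⟨Γ₂.gluingOfEmbedding f₂ g₂ (Sum.inr_injective.comp Sum.inl_injective)
      (Sum.inr_injective.comp Sum.inl_injective) hh₂ ht₂ rfl⟩,
    ⟨Γ₁.gluingOfEmbedding f₁ g₁ (Sum.inr_injective.comp Sum.inr_injective)
      (Sum.inr_injective.comp Sum.inr_injective) hh₁ ht₁ rfl⟩, ?_, ?_, ?_⟩
  · refine Set.disjoint_of_subset (LineSystem.ends_range_subset _ _ hh₃ ht₃)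
      (LineSystem.ends_range_subset _ _ hh₂ ht₂) (Set.disjoint_left.2 ?_)
    rintro _ ⟨v, rfl⟩ ⟨w, h⟩
    exact Sum.inr_ne_inl h
  · refine Set.disjoint_of_subset (LineSystem.ends_range_subset _ _ hh₂ ht₂)
      (LineSystem.ends_range_subset _ _ hh₁ ht₁) (Set.disjoint_left.2 ?_)
    rintro _ ⟨v, rfl⟩ ⟨w, h⟩
    exact Sum.inr_ne_inl (Sum.inr_injective h)
  · refine Set.disjoint_of_subset (LineSystem.ends_range_subset _ _ hh₃ ht₃)
      (LineSystem.ends_range_subset _ _ hh₁ ht₁) (Set.disjoint_left.2 ?_)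
    rintro _ ⟨v, rfl⟩ ⟨w, h⟩
    exact Sum.inr_ne_inl h

end HWGraph

namespace DiagramAlg

open LineSystem

variable (K : Type*) [Field K]

theorem induction_of {p : DiagramAlg K → Prop} (x : DiagramAlg K) (zero : p 0)
    (add : ∀ x y, p x → p y → p (x + y)) (smul : ∀ (c : K) x, p x → p (c • x))
    (of : ∀ Γ, p (of K (.mk Γ))) : p x := by
  have h : x ∈ Submodule.span K (Set.range (basis K)) := (basis K).span_eq ▸ Submodule.mem_top
  induction h using Submodule.span_induction with
  | mem x h =>
    obtain ⟨D, rfl⟩ := h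
    exact Quotient.inductionOn D of
  | zero => exact zero
  | add x y _ _ hx hy => exact add x y hx hy
  | smul c x _ hx => exact smul c x hx

theorem hom_ext_mk {M : Type*} [AddCommMonoid M] [Module K M] {f g : DiagramAlg K →ₗ[K] M}
    (h : ∀ Γ, f (of K (.mk Γ)) = g (of K (.mk Γ))) : f = g :=
  (basis K).ext fun D => Quotient.inductionOn D h

theorem mul_assoc_of (Γ₃ Γ₂ Γ₁ : HWGraph) :
    mul K (mul K (of K (.mk Γ₃)) (of K (.mk Γ₂))) (of K (.mk Γ₁)) =
      mul K (of K (.mk Γ₃)) (mul K (of K (.mk Γ₂)) (of K (.mk Γ₁))) := by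
  obtain ⟨B, A₃, A₂, A₁, ⟨P₃⟩, ⟨P₂⟩, ⟨P₁⟩, h₃₂, h₂₁, h₃₁⟩ :=
    HWGraph.exists_disjoint_triple Γ₃ Γ₂ Γ₁
  rw [← P₃.diagram_eq, ← P₂.diagram_eq, ← P₁.diagram_eq, mul_of, mul_of,
    mulDiagram_diagram K P₃.realizable P₂.realizable h₃₂,
    mulDiagram_diagram K P₂.realizable P₁.realizable h₂₁, map_sum, map_sum, LinearMap.sum_apply]
  have hL : ∀ N ∈ (pairings (B.freeIn A₃ ∅) (B.freeOut A₂ ∅)).toFinite.toFinset,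
      mul K (of K (B.diagram (A₃ ∪ A₂) (∅ ∪ ∅ ∪ N))) (of K (B.diagram A₁ ∅)) =
      ∑ N' ∈ (pairings (B.freeIn (A₃ ∪ A₂) N) (B.freeOut A₁ ∅)).toFinite.toFinset,
        of K (B.diagram (A₃ ∪ A₂ ∪ A₁) (N ∪ N')) := by
    intro N hN
    rw [Set.Finite.mem_toFinset] at hN
    have hr := P₃.realizable.union P₂.realizable h₃₂ hN
    rw [mul_of, mulDiagram_diagram K hr P₁.realizable
      (by rw [ends_union]; exact h₃₁.union_left h₂₁)]
    simp only [Set.empty_union, Set.union_empty]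
  have hR : ∀ N ∈ (pairings (B.freeIn A₂ ∅) (B.freeOut A₁ ∅)).toFinite.toFinset,
      mul K (of K (B.diagram A₃ ∅)) (of K (B.diagram (A₂ ∪ A₁) (∅ ∪ ∅ ∪ N))) =
      ∑ N' ∈ (pairings (B.freeIn A₃ ∅) (B.freeOut (A₂ ∪ A₁) N)).toFinite.toFinset,
        of K (B.diagram (A₃ ∪ A₂ ∪ A₁) (N ∪ N')) := by
    intro N hN
    rw [Set.Finite.mem_toFinset] at hN
    have hr := P₂.realizable.union P₁.realizable h₂₁ hN
    rw [mul_of, mulDiagram_diagram K P₃.realizable hr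
      (by rw [ends_union]; exact h₃₂.union_right h₃₁)]
    simp only [Set.empty_union, Set.union_assoc]
  rw [Finset.sum_congr rfl hL, Finset.sum_congr rfl hR]
  exact sum_pairings_assoc (disjoint_of_ends h₃₂) (disjoint_of_ends h₂₁)
    fun M => of K (B.diagram (A₃ ∪ A₂ ∪ A₁) M)

theorem comul_mul_of (Γ₂ Γ₁ : HWGraph) :
    comul K (mul K (of K (.mk Γ₂)) (of K (.mk Γ₁))) =
      TensorProduct.map₂ (mul K) (mul K) (comul K (of K (.mk Γ₂))) (comul K (of K (.mk Γ₁))) := by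
  obtain ⟨B, -, A₂, A₁, -, ⟨P₂⟩, ⟨P₁⟩, -, h₂₁, -⟩ :=
    HWGraph.exists_disjoint_triple HWGraph.void Γ₂ Γ₁
  rw [← P₂.diagram_eq, ← P₁.diagram_eq, mul_of, comul_of, comul_of,
    mulDiagram_diagram K P₂.realizable P₁.realizable h₂₁,
    comulDiagram_diagram K P₂.realizable, comulDiagram_diagram K P₁.realizable,
    map_sum, LinearMap.map_sum₂]
  have hL : ∀ N ∈ (pairings (B.freeIn A₂ ∅) (B.freeOut A₁ ∅)).toFinite.toFinset,
      comul K (of K (B.diagram (A₂ ∪ A₁) (∅ ∪ ∅ ∪ N))) =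
      ∑ D ∈ (saturated (A₂ ∪ A₁) N).toFinite.toFinset, of K (B.diagram D {p ∈ N | p.1 ∈ D}) ⊗ₜ[K]
        of K (B.diagram ((A₂ ∪ A₁) \ D) {p ∈ N | p.1 ∈ (A₂ ∪ A₁) \ D}) := by
    intro N hN
    rw [Set.Finite.mem_toFinset] at hN
    have hr := P₂.realizable.union P₁.realizable h₂₁ hN
    rw [Set.empty_union, Set.empty_union] at hr
    rw [Set.empty_union, Set.empty_union, comul_of, comulDiagram_diagram K hr]
  rw [Finset.sum_congr rfl hL]
  rw [sum_pairings_saturated (disjoint_of_ends h₂₁)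
    fun D N D' N' => of K (B.diagram D N) ⊗ₜ[K] of K (B.diagram D' N')]
  refine Finset.sum_congr rfl fun D₂ hD₂ => ?_
  rw [map_sum]
  refine Finset.sum_congr rfl fun D₁ hD₁ => ?_
  rw [Set.Finite.mem_toFinset] at hD₂ hD₁
  have e : ∀ D : Set B.Line, {p : B.Line × B.Line | p ∈ (∅ : Set _) ∧ p.1 ∈ D} = ∅ := by simp
  have r₂ := P₂.realizable.restrict hD₂
  have r₁ := P₁.realizable.restrict hD₁
  have r₂' := P₂.realizable.restrict (P₂.realizable.diff_mem_saturated hD₂)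
  have r₁' := P₁.realizable.restrict (P₁.realizable.diff_mem_saturated hD₁)
  rw [e] at r₂ r₁ r₂' r₁'
  rw [e, e, e, e, TensorProduct.map₂_apply_tmul, TensorProduct.map_tmul, mul_of, mul_of,
    mulDiagram_diagram K r₂ r₁ (Set.disjoint_of_subset (ends_mono hD₂.1) (ends_mono hD₁.1) h₂₁),
    mulDiagram_diagram K r₂' r₁' (Set.disjoint_of_subset (ends_mono Set.sdiff_subset)
      (ends_mono Set.sdiff_subset) h₂₁)]
  simp only [Set.empty_union, TensorProduct.sum_tmul, TensorProduct.tmul_sum]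
  exact Finset.sum_comm

end DiagramAlg

/-! ### Unit, counit and coassociativity -/

namespace HWGraph

/-- A graph is presented by its own lines. -/
def gluing (Γ : HWGraph) : Γ.lineSystem.Gluing Set.univ ∅ Γ :=
  Γ.gluingOfEmbedding (B := Γ.lineSystem) id id Function.injective_id
    Function.injective_id (fun e => by simp [lineSystem]) (fun e => by simp [lineSystem])
    Set.range_id

/-- The void graph is presented by the empty set of lines. -/
def voidGluing (B : LineSystem) : B.Gluing ∅ ∅ void :=
  void.gluingOfEmbedding (B := B) Empty.elim Empty.elim (fun e => e.elim)
    (fun e => e.elim) (fun e => e.elim) (fun e => e.elim) (Set.range_eq_empty (ι := Empty) _)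

theorem map_head_restrict (Γ : HWGraph) (L : Set Γ.E) (e : (Γ.restrict L).E) :
    ((Γ.restrict L).head e).map Subtype.val = Γ.head e.1 := by
  simp [restrict, Option.map_pmap, Option.pmap_eq_map]

theorem map_tail_restrict (Γ : HWGraph) (L : Set Γ.E) (e : (Γ.restrict L).E) :
    ((Γ.restrict L).tail e).map Subtype.val = Γ.tail e.1 := by
  simp [restrict, Option.map_pmap, Option.pmap_eq_map]

theorem mk_restrict_restrict (Γ : HWGraph) (L : Set Γ.E) (L' : Set (Γ.restrict L).E) :
    Diagram.mk ((Γ.restrict L).restrict L') =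
      .mk (Γ.restrict ((fun e : (Γ.restrict L).E => e.1) '' L')) := by
  have P := ((Γ.restrict L).restrict L').gluingOfEmbedding (B := Γ.lineSystem)
    (fun e => e.1.1) (Subtype.val ∘ Subtype.val)
    (Subtype.val_injective.comp Subtype.val_injective)
    (Subtype.val_injective.comp Subtype.val_injective)
    (fun e => ((map_head_restrict Γ L e.1).symm.trans (congrArg _
      (map_head_restrict (Γ.restrict L) L' e).symm)).trans (Option.map_map _ _ _))
    (fun e => ((map_tail_restrict Γ L e.1).symm.trans (congrArg _
      (map_tail_restrict (Γ.restrict L) L' e).symm)).trans (Option.map_map _ _ _))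
    (A := (fun e : (Γ.restrict L).E => e.1) '' L') (by
      ext x
      constructor
      · rintro ⟨e, rfl⟩
        exact ⟨e.1, e.2, rfl⟩
      · rintro ⟨e, he, rfl⟩
        exact ⟨⟨e, he⟩, rfl⟩)
  have P' := (Γ.restrict ((fun e : (Γ.restrict L).E => e.1) '' L')).gluingOfEmbedding
    (B := Γ.lineSystem) Subtype.val Subtype.val Subtype.val_injective Subtype.val_injective
    (fun e => (map_head_restrict Γ _ e).symm) (fun e => (map_tail_restrict Γ _ e).symm)
    Subtype.range_coe
  exact P.diagram_eq.symm.trans P'.diagram_eq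

theorem mk_eq_void_iff (Γ : HWGraph) : Diagram.mk Γ = .void ↔ IsEmpty Γ.E := by
  constructor
  · intro h
    obtain ⟨i⟩ := Quotient.exact h
    exact i.onE.isEmpty_congr.2 inferInstanceAs (IsEmpty Empty)
  · intro h
    have : IsEmpty Γ.V := ⟨fun v => (Γ.covered v).elim fun e _ => h.elim e⟩
    exact Diagram.mk_eq ⟨Equiv.equivOfIsEmpty _ Empty, Equiv.equivOfIsEmpty _ Empty,
      fun e => h.elim e, fun e => h.elim e⟩

instance (Γ₂ Γ₁ : HWGraph) (m : Matching Γ₂.Incoming Γ₁.Outgoing) [h : Nonempty Γ₂.E] :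
    Nonempty (Γ₂.comp Γ₁ m).E := by
  obtain ⟨e⟩ := h
  by_cases hm : ∃ p ∈ m.1, p.1.1 = e
  · obtain ⟨p, hp, -⟩ := hm
    exact ⟨.inr (.inr ⟨p, hp⟩)⟩
  · push Not at hm
    exact ⟨.inl ⟨e, hm⟩⟩

end HWGraph

namespace LineSystem

open DiagramAlg

variable {B : LineSystem} {A D : Set B.Line} (K : Type*) [Field K]

theorem ends_empty : B.ends ∅ = ∅ := by simp [ends]

theorem saturated_empty : saturated A ∅ = 𝒫 A := by
  ext D
  simp [saturated]

theorem Realizable.mono (h : B.Realizable A ∅) (hD : D ⊆ A) : B.Realizable D ∅ := by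
  have := h.restrict (D := D) (by rwa [saturated_empty])
  simpa using this

/-- Without glued pairs, the coproduct is a sum over all subsets of lines. -/
theorem comulDiagram_diagram_empty (h : B.Realizable A ∅) :
    comulDiagram K (B.diagram A ∅) = ∑ D ∈ (𝒫 A).toFinite.toFinset,
      of K (B.diagram D ∅) ⊗ₜ[K] of K (B.diagram (A \ D) ∅) := by
  rw [comulDiagram_diagram K h]
  have e : ∀ D : Set B.Line, {p : B.Line × B.Line | p ∈ (∅ : Set _) ∧ p.1 ∈ D} = ∅ := by simp
  simp only [e, saturated_empty]

theorem Realizable.diagram_eq_void_iff (h : B.Realizable A ∅) :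
    B.diagram A ∅ = .void ↔ A = ∅ := by
  obtain ⟨Γ, ⟨P⟩⟩ := h
  rw [P.diagram_eq, HWGraph.mk_eq_void_iff]
  constructor
  · intro h
    refine Set.eq_empty_of_forall_notMem fun x hx => ?_
    obtain ⟨e, -⟩ := P.exists_headLine hx (by simp)
    exact h.elim e
  · rintro rfl
    exact ⟨P.headLine_mem⟩

end LineSystem

namespace DiagramAlg

open LineSystem

variable (K : Type*) [Field K]

theorem one_mul_of (Γ : HWGraph) : mul K (one K) (of K (.mk Γ)) = of K (.mk Γ) := by
  have P := Γ.gluing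
  have V := HWGraph.voidGluing Γ.lineSystem
  rw [one, Diagram.void, ← V.diagram_eq, ← P.diagram_eq, mul_of,
    mulDiagram_diagram K V.realizable P.realizable (by simp [ends_empty])]
  have h : pairings (Γ.lineSystem.freeIn ∅ ∅) (Γ.lineSystem.freeOut Set.univ ∅) = {∅} := by
    ext N
    simp only [pairings, freeIn, Set.mem_ofPred_eq, Set.mem_empty_iff_false, false_and,
      Set.mem_singleton_iff, imp_false]
    constructor
    · exact fun h => Set.eq_empty_of_forall_notMem h.1
    · rintro rfl
      simp
  simp [h]

theorem mul_one_of (Γ : HWGraph) : mul K (of K (.mk Γ)) (one K) = of K (.mk Γ) := by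
  have P := Γ.gluing
  have V := HWGraph.voidGluing Γ.lineSystem
  rw [one, Diagram.void, ← V.diagram_eq, ← P.diagram_eq, mul_of,
    mulDiagram_diagram K P.realizable V.realizable (by simp [ends_empty])]
  have h : pairings (Γ.lineSystem.freeIn Set.univ ∅) (Γ.lineSystem.freeOut ∅ ∅) = {∅} := by
    ext N
    simp only [pairings, freeOut, Set.mem_ofPred_eq, Set.mem_empty_iff_false, false_and, and_false,
      Set.mem_singleton_iff, imp_false]
    constructor
    · exact fun h => Set.eq_empty_of_forall_notMem h.1
    · rintro rfl
      simp
  simp [h]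

open scoped Classical in
theorem counit_of (D : Diagram) : counit K (of K D) = if D = .void then 1 else 0 := by
  simp [counit, of, Finsupp.single_apply]

theorem counit_mk_of_nonempty (Γ : HWGraph) [Nonempty Γ.E] : counit K (of K (.mk Γ)) = 0 := by
  rw [counit_of, if_neg]
  rw [HWGraph.mk_eq_void_iff]
  exact not_isEmpty_of_nonempty _

theorem counit_one : counit K (one K) = 1 := by rw [one, counit_of, if_pos rfl]

theorem of_eq_one (Γ : HWGraph) [h : IsEmpty Γ.E] : of K (.mk Γ) = one K := by
  rw [(HWGraph.mk_eq_void_iff Γ).2 h]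
  rfl

theorem mulDiagram_mk (Γ₂ Γ₁ : HWGraph) : mulDiagram K (.mk Γ₂) (.mk Γ₁) =
    ∑ m : HWGraph.Matching Γ₂.Incoming Γ₁.Outgoing, of K (.mk (Γ₂.comp Γ₁ m)) := rfl

theorem comulDiagram_mk (Γ : HWGraph) : comulDiagram K (.mk Γ) =
    ∑ L : Set Γ.E, of K (.mk (Γ.restrict L)) ⊗ₜ[K] of K (.mk (Γ.restrict Lᶜ)) := rfl

theorem counit_mul_of (Γ₂ Γ₁ : HWGraph) :
    counit K (mul K (of K (.mk Γ₂)) (of K (.mk Γ₁))) =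
      counit K (of K (.mk Γ₂)) * counit K (of K (.mk Γ₁)) := by
  rcases isEmpty_or_nonempty Γ₂.E with h | h
  · rw [of_eq_one, one_mul_of, counit_one, one_mul]
  · rw [counit_mk_of_nonempty, zero_mul, mul_of, mulDiagram_mk, map_sum]
    exact Finset.sum_eq_zero fun m _ => counit_mk_of_nonempty K _

theorem coassoc_of (Γ : HWGraph) :
    TensorProduct.assoc K _ _ _ ((comul K).rTensor _ (comul K (of K (.mk Γ)))) =
      (comul K).lTensor _ (comul K (of K (.mk Γ))) := by
  have P := Γ.gluing
  have hr := fun D => P.realizable.mono (Set.subset_univ D)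
  rw [← P.diagram_eq, comul_of, comulDiagram_diagram_empty K P.realizable]
  simp only [map_sum, LinearMap.rTensor_tmul, LinearMap.lTensor_tmul, comul_of,
    comulDiagram_diagram_empty K (hr _), TensorProduct.sum_tmul, TensorProduct.tmul_sum,
    TensorProduct.assoc_tmul]
  rw [Finset.sum_sigma', Finset.sum_sigma']
  refine Finset.sum_bij' (fun s _ => ⟨s.2, s.1 \ s.2⟩) (fun s _ => ⟨s.1 ∪ s.2, s.1⟩) ?_ ?_ ?_ ?_ ?_
  · rintro ⟨D, D'⟩ h
    simp only [Finset.mem_sigma, Set.Finite.mem_toFinset, Set.mem_powerset_iff] at h ⊢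
    grind
  · rintro ⟨D, D'⟩ h
    simp only [Finset.mem_sigma, Set.Finite.mem_toFinset, Set.mem_powerset_iff] at h ⊢
    grind
  · rintro ⟨D, D'⟩ h
    simp only [Finset.mem_sigma, Set.Finite.mem_toFinset, Set.mem_powerset_iff] at h
    simp [Set.union_eq_right.2 h.2]
  · rintro ⟨D, D'⟩ h
    simp only [Finset.mem_sigma, Set.Finite.mem_toFinset, Set.mem_powerset_iff] at h
    have : (D ∪ D') \ D = D' := by
      ext x
      have := @h.2 x
      simp only [Set.mem_sdiff] at this
      simp only [Set.mem_sdiff, Set.mem_union]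
      tauto
    simp [this]
  · rintro ⟨D, D'⟩ h
    simp only [Finset.mem_sigma, Set.Finite.mem_toFinset, Set.mem_powerset_iff] at h
    have : (Set.univ \ D') \ (D \ D') = Set.univ \ D := by
      ext x
      have := @h.2 x
      simp only [Set.mem_sdiff]
      tauto
    rw [this]

theorem counit_comul_of (Γ : HWGraph) :
    (counit K).rTensor _ (comul K (of K (.mk Γ))) = 1 ⊗ₜ[K] of K (.mk Γ) := by
  classical
  have P := Γ.gluing
  have hr := fun D => P.realizable.mono (Set.subset_univ D)
  rw [← P.diagram_eq, comul_of, comulDiagram_diagram_empty K P.realizable]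
  simp only [map_sum, LinearMap.rTensor_tmul, counit_of, (hr _).diagram_eq_void_iff]
  rw [Finset.sum_eq_single ∅]
  · simp
  · intro D _ hD
    simp [hD]
  · simp

theorem comul_counit_of (Γ : HWGraph) :
    (counit K).lTensor _ (comul K (of K (.mk Γ))) = of K (.mk Γ) ⊗ₜ[K] 1 := by
  classical
  have P := Γ.gluing
  have hr := fun D => P.realizable.mono (Set.subset_univ D)
  rw [← P.diagram_eq, comul_of, comulDiagram_diagram_empty K P.realizable]
  simp only [map_sum, LinearMap.lTensor_tmul, counit_of, (hr _).diagram_eq_void_iff]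
  rw [Finset.sum_eq_single Set.univ]
  · simp
  · intro D _ hD
    have : Set.univ \ D ≠ ∅ := fun h => hD (Set.univ_subset_iff.1 (Set.sdiff_eq_empty.1 h))
    simp [this]
  · simp

theorem comul_one : comul K (one K) = one K ⊗ₜ[K] one K := by
  have P := HWGraph.voidGluing HWGraph.void.lineSystem
  rw [one, Diagram.void, ← P.diagram_eq, comul_of, comulDiagram_diagram_empty K P.realizable]
  simp

end DiagramAlg

/-! ### The antipode as a geometric series in the convolution ring -/

namespace DiagramAlg

variable (K : Type*) [Field K]

/-- The algebra of diagrams as a ring. -/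
instance ring : Ring (DiagramAlg K) where
  __ := instAddCommGroup K
  mul x y := mul K x y
  one := one K
  left_distrib x y z := map_add (mul K x) y z
  right_distrib x y z := LinearMap.map_add₂ (mul K) x y z
  zero_mul x := LinearMap.map_zero₂ (mul K) x
  mul_zero x := map_zero (mul K x)
  mul_assoc x y z := by
    change mul K (mul K x y) z = mul K x (mul K y z)
    induction x using induction_of with
    | zero => simp
    | add x x' hx hx' => simp [hx, hx']
    | smul c x hx => simp [hx]
    | of Γ₃ =>
    induction y using induction_of with
    | zero => simp
    | add x x' hx hx' => simp [hx, hx']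
    | smul c x hx => simp [hx]
    | of Γ₂ =>
    induction z using induction_of with
    | zero => simp
    | add x x' hx hx' => simp [hx, hx']
    | smul c x hx => simp [hx]
    | of Γ₁ => exact mul_assoc_of K Γ₃ Γ₂ Γ₁
  one_mul x := by
    change mul K (one K) x = x
    exact LinearMap.congr_fun (hom_ext_mk K (g := .id) (one_mul_of K)) x
  mul_one x := by
    change (mul K).flip (one K) x = x
    exact LinearMap.congr_fun (hom_ext_mk K (f := (mul K).flip (one K)) (g := .id) (mul_one_of K)) x

theorem mul_def (x y : DiagramAlg K) : x * y = mul K x y := rfl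

/-- The algebra of diagrams as an algebra over `K`. -/
instance algebra : Algebra K (DiagramAlg K) :=
  Algebra.ofModule (fun c x y => LinearMap.map_smul₂ (mul K) c x y)
    fun c x y => map_smul (mul K x) c y

/-- The algebra of diagrams as a coalgebra. -/
instance coalgebra : Coalgebra K (DiagramAlg K) where
  comul := comul K
  counit := counit K
  coassoc := hom_ext_mk K (coassoc_of K)
  rTensor_counit_comp_comul := hom_ext_mk K (counit_comul_of K)
  lTensor_counit_comp_comul := hom_ext_mk K (comul_counit_of K)

theorem mul'_eq : LinearMap.mul' K (DiagramAlg K) = TensorProduct.lift (mul K) := by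
  ext x y
  simp [mul_def]

open WithConv

/-- The identity minus the unit of the convolution ring: the projection that kills the void diagram
and fixes all other ones. -/
def reduction : WithConv (DiagramAlg K →ₗ[K] DiagramAlg K) := toConv LinearMap.id - 1

theorem reduction_apply (x : DiagramAlg K) :
    reduction K x = x - counit K x • (1 : DiagramAlg K) := by
  rw [← Algebra.algebraMap_eq_smul_one]
  rfl

theorem conv_mul_of (f g : WithConv (DiagramAlg K →ₗ[K] DiagramAlg K)) (Γ : HWGraph) :
    (f * g) (of K (.mk Γ)) =
      ∑ L : Set Γ.E, f (of K (.mk (Γ.restrict L))) * g (of K (.mk (Γ.restrict Lᶜ))) := by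
  rw [LinearMap.convMul_apply]
  change LinearMap.mul' K _ (TensorProduct.map f.ofConv g.ofConv (comul K _)) = _
  rw [comul_of, comulDiagram_mk, map_sum, map_sum]
  rfl

theorem reduction_of_isEmpty (Γ : HWGraph) [IsEmpty Γ.E] : reduction K (of K (.mk Γ)) = 0 := by
  rw [reduction_apply, of_eq_one, counit_one, one_smul]
  exact sub_self _

theorem reduction_of_nonempty (Γ : HWGraph) [Nonempty Γ.E] :
    reduction K (of K (.mk Γ)) = of K (.mk Γ) := by
  rw [reduction_apply, counit_mk_of_nonempty, zero_smul, sub_zero]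

open scoped Classical in
/-- The convolution powers of the projection, as sums over all ordered partitions of the lines into
`n` possibly empty subsets. -/
theorem reduction_pow_of (n : ℕ) (Γ : HWGraph) : (reduction K ^ n) (of K (.mk Γ)) =
    ∑ c : Γ.E → Fin n,
      (List.ofFn fun k => reduction K (of K (.mk (Γ.restrict (c ⁻¹' {k}))))).prod := by
  induction n generalizing Γ with
  | zero =>
    rw [pow_zero, LinearMap.convOne_apply]
    change algebraMap K _ (counit K _) = _
    rcases isEmpty_or_nonempty Γ.E with h | h
    · rw [of_eq_one K Γ, counit_one]
      simp
    · rw [counit_mk_of_nonempty, map_zero]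
      have : IsEmpty (Γ.E → Fin 0) := ⟨fun c => (c h.some).elim0⟩
      simp
  | succ n ih =>
    rw [pow_succ', conv_mul_of]
    simp only [ih, Finset.mul_sum]
    rw [Finset.sum_sigma']
    refine Finset.sum_bij (fun s _ e => if h : e ∈ s.1 then 0 else (s.2 ⟨e, h⟩).succ) ?_ ?_ ?_ ?_
    · exact fun _ _ => Finset.mem_univ _
    · rintro ⟨L, c⟩ - ⟨L', c'⟩ - h
      have hL : ∀ e, e ∈ L ↔ e ∈ L' := by
        intro e
        have := congrFun h e
        by_cases h1 : e ∈ L <;> by_cases h2 : e ∈ L' <;> simp [h1, h2, Fin.succ_ne_zero] at this ⊢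
        exact (Fin.succ_ne_zero _ this.symm).elim
      obtain rfl : L = L' := Set.ext hL
      congr 1
      funext ⟨e, he⟩
      have he' : e ∉ L := he
      have := congrFun h e
      simpa [he'] using this
    · intro c _
      refine ⟨⟨c ⁻¹' {0}, fun e => (c e.1).pred e.2⟩, by simp, ?_⟩
      funext e
      by_cases h : c e = 0
      · simp [h]
      · simp only [Set.mem_preimage, Set.mem_singleton_iff, h, dif_neg, not_false_eq_true]
        exact Fin.succ_pred _ h
    · rintro ⟨L, c⟩ -
      rw [List.ofFn_succ, List.prod_cons]
      have h0 : (fun e => if h : e ∈ L then 0 else (c ⟨e, h⟩).succ) ⁻¹' {0} = L := by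
        ext e
        by_cases h : e ∈ L <;> simp [h, Fin.succ_ne_zero]
      have hk : ∀ k : Fin n, (fun e => if h : e ∈ L then 0 else (c ⟨e, h⟩).succ) ⁻¹' {k.succ} =
          Subtype.val '' (c ⁻¹' {k}) := by
        intro k
        ext e
        by_cases h : e ∈ L
        · simp [h, (Fin.succ_ne_zero _).symm]
        · simp only [Set.mem_preimage, h, dif_neg, not_false_eq_true, Set.mem_singleton_iff,
            Fin.succ_inj, Set.mem_image]
          constructor
          · exact fun hc => ⟨⟨e, h⟩, hc, rfl⟩
          · rintro ⟨e, hc, rfl⟩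
            exact hc
      rw [h0]
      congr 3
      funext k
      rw [hk, HWGraph.mk_restrict_restrict]
      rfl

open scoped Classical in
/-- Partitions with an empty part do not contribute, so the convolution powers are the sums in the
definition of the antipode. -/
theorem reduction_pow_of_eq_sum_surjective (n : ℕ) (Γ : HWGraph) :
    (reduction K ^ n) (of K (.mk Γ)) = ∑ c : {c : Γ.E → Fin n // Function.Surjective c},
      (List.ofFn fun k : Fin n => of K (.mk (Γ.restrict (c.1 ⁻¹' {k})))).foldr
        (fun x y => mul K x y) (one K) := by
  rw [reduction_pow_of]
  symm
  refine Finset.sum_of_injOn Subtype.val Subtype.val_injective.injOn (by simp) ?_ ?_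
  · intro c _ hc
    have hc' : ¬ Function.Surjective c := fun h => hc ⟨⟨c, h⟩, by simp, rfl⟩
    rw [Function.Surjective, not_forall] at hc'
    obtain ⟨k, hk⟩ := hc'
    refine List.prod_eq_zero (List.mem_ofFn.2 ⟨k, ?_⟩)
    have : IsEmpty (Γ.restrict (c ⁻¹' {k})).E := ⟨fun e => hk ⟨e.1, e.2⟩⟩
    exact reduction_of_isEmpty K _
  · intro c _
    rw [List.prod_eq_foldr]
    congr 2
    funext k
    obtain ⟨e, he⟩ := c.2 k
    have : Nonempty (Γ.restrict (c.1 ⁻¹' {k})).E := ⟨⟨e, he⟩⟩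
    exact (reduction_of_nonempty K _).symm

theorem reduction_pow_eq_zero {n : ℕ} {Γ : HWGraph} (h : Nat.card Γ.E < n) :
    (reduction K ^ n) (of K (.mk Γ)) = 0 := by
  classical
  rw [reduction_pow_of_eq_sum_surjective]
  refine Finset.sum_eq_zero fun c _ => ?_
  have := Nat.card_le_card_of_surjective _ c.2
  rw [Nat.card_fin] at this
  omega

/-- The antipode is the geometric series of the negative projection, which may be cut off at any
bound for the number of lines. -/
theorem antipode_mk (Γ : HWGraph) {N : ℕ} (h : Nat.card Γ.E ≤ N) :
    antipode K (of K (.mk Γ)) =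
      (∑ n ∈ Finset.range (N + 1), (-reduction K) ^ n) (of K (.mk Γ)) := by
  classical
  have key : ∀ n, ((-reduction K) ^ n) (of K (.mk Γ)) =
      (-1 : K) ^ n • (reduction K ^ n) (of K (.mk Γ)) := by
    intro n
    rw [← neg_one_smul K (reduction K), smul_pow]
    rfl
  rw [ofConv_sum, LinearMap.sum_apply, ← Finset.sum_subset (Finset.range_mono
    (Nat.succ_le_succ h))]
  · rw [antipode_of]
    refine Finset.sum_congr rfl fun n _ => ?_
    rw [key, reduction_pow_of_eq_sum_surjective, Finset.smul_sum]
  · intro n _ hn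
    rw [key, reduction_pow_eq_zero K (by simpa [Nat.lt_succ_iff] using hn), smul_zero]

theorem antipode_restrict (Γ : HWGraph) (L : Set Γ.E) :
    antipode K (of K (.mk (Γ.restrict L))) =
      (∑ n ∈ Finset.range (Nat.card Γ.E + 1), (-reduction K) ^ n)
        (of K (.mk (Γ.restrict L))) :=
  antipode_mk K _ (Nat.card_le_card_of_injective (Subtype.val : L → Γ.E) Subtype.val_injective)

theorem one_sub_neg_reduction_pow (Γ : HWGraph) :
    (1 - (-reduction K) ^ (Nat.card Γ.E + 1)) (of K (.mk Γ)) =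
      (1 : WithConv (DiagramAlg K →ₗ[K] DiagramAlg K)) (of K (.mk Γ)) := by
  have h : ((-reduction K) ^ (Nat.card Γ.E + 1)) (of K (.mk Γ)) = 0 := by
    rw [← neg_one_smul K (reduction K), smul_pow, ofConv_smul, LinearMap.smul_apply,
      reduction_pow_eq_zero K (Nat.lt_succ_self _), smul_zero]
  rw [ofConv_sub, LinearMap.sub_apply, h, sub_zero]

theorem toConv_id_eq : (toConv LinearMap.id : WithConv (DiagramAlg K →ₗ[K] DiagramAlg K)) =
    1 - -reduction K := by
  simp [reduction]

theorem antipode_convMul_id :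
    toConv (antipode K) * (toConv LinearMap.id : WithConv (DiagramAlg K →ₗ[K] DiagramAlg K)) =
      1 := by
  refine ofConv_injective (hom_ext_mk K fun Γ => ?_)
  rw [← one_sub_neg_reduction_pow, ← geom_sum_mul_neg, ← toConv_id_eq, conv_mul_of, conv_mul_of]
  refine Finset.sum_congr rfl fun L _ => ?_
  rw [← antipode_restrict]

theorem id_convMul_antipode :
    (toConv LinearMap.id : WithConv (DiagramAlg K →ₗ[K] DiagramAlg K)) * toConv (antipode K) =
      1 := by
  refine ofConv_injective (hom_ext_mk K fun Γ => ?_)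
  rw [← one_sub_neg_reduction_pow, ← mul_neg_geom_sum, ← toConv_id_eq, conv_mul_of, conv_mul_of]
  refine Finset.sum_congr rfl fun L _ => ?_
  rw [← antipode_restrict]

theorem isHopfAlgebra : IsHopfAlgebra (mul K) (one K) (comul K) (counit K) (antipode K) where
  mul_assoc := mul_assoc (G := DiagramAlg K)
  one_mul := one_mul (M := DiagramAlg K)
  mul_one := mul_one (M := DiagramAlg K)
  coassoc := Coalgebra.coassoc (R := K) (A := DiagramAlg K)
  counit_comul := Coalgebra.rTensor_counit_comul (R := K) (A := DiagramAlg K)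
  comul_counit := Coalgebra.lTensor_counit_comul (R := K) (A := DiagramAlg K)
  comul_mul x y := by
    induction x using induction_of with
    | zero => simp
    | add x x' hx hx' => simp [hx, hx']
    | smul c x hx => simp [hx]
    | of Γ₂ =>
    induction y using induction_of with
    | zero => simp
    | add x x' hx hx' => simp [hx, hx']
    | smul c x hx => simp [hx]
    | of Γ₁ => exact comul_mul_of K Γ₂ Γ₁
  comul_one := comul_one K
  counit_mul x y := by
    induction x using induction_of with
    | zero => simp
    | add x x' hx hx' => simp [hx, hx', add_mul]
    | smul c x hx => simp [hx, mul_assoc]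
    | of Γ₂ =>
    induction y using induction_of with
    | zero => simp
    | add x x' hx hx' => simp [hx, hx', mul_add]
    | smul c x hx => simp [hx, mul_left_comm]
    | of Γ₁ => exact counit_mul_of K Γ₂ Γ₁
  counit_one := counit_one K
  antipode_mul_id x := by
    have h := LinearMap.congr_fun (congrArg ofConv (antipode_convMul_id K)) x
    rw [LinearMap.convMul_apply, mul'_eq, LinearMap.convOne_apply,
      Algebra.algebraMap_eq_smul_one] at h
    exact h
  id_mul_antipode x := by
    have h := LinearMap.congr_fun (congrArg ofConv (id_convMul_antipode K)) x
    rw [LinearMap.convMul_apply, mul'_eq, LinearMap.convOne_apply,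
      Algebra.algebraMap_eq_smul_one] at h
    exact h

end DiagramAlg

/-! ### Counting matchings and lines, and normal ordering -/

namespace LineSystem

/-- There are `(|X| choose i) * |Y| * (|Y| - 1) * ⋯ * (|Y| - i + 1)` matchings of `X` and `Y` with
`i` pairs: choose the subset of `X` and its injection into `Y`. -/
theorem sum_pairings_ncard {R : Type*} [AddCommMonoid R] {C : Type} [Finite C] (X Y : Set C)
    (f : ℕ → R) :
    ∑ N ∈ (pairings X Y).toFinite.toFinset, f N.ncard =
      ∑ i ∈ Finset.range (X.ncard + 1),
        X.ncard.choose i • Y.ncard.descFactorial i • f i := by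
  classical
  have := Fintype.ofFinite X
  have := Fintype.ofFinite Y
  have hX : X.ncard = Fintype.card X := by rw [← Nat.card_coe_set_eq, Nat.card_eq_fintype_card]
  have hY : Y.ncard = Fintype.card Y := by rw [← Nat.card_coe_set_eq, Nat.card_eq_fintype_card]
  rw [hX, hY, ← Finset.card_univ, ← Finset.sum_powerset_apply_card
    (fun i => (Fintype.card Y).descFactorial i • f i)]
  have hc : ∀ s : Finset X, (Fintype.card Y).descFactorial s.card • f s.card =
      ∑ _g : s ↪ Y, f s.card := by
    intro s
    rw [Finset.sum_const, Finset.card_univ, Fintype.card_embedding_eq, Fintype.card_coe]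
  rw [Finset.sum_congr rfl fun s _ => hc s, Finset.sum_sigma']
  symm
  have hinj : ∀ (s : Finset X) (g : s ↪ Y),
      Function.Injective fun a : s => ((a.1.1, (g a).1) : C × C) :=
    fun s g a b h => Subtype.ext (Subtype.ext (congrArg Prod.fst h))
  refine Finset.sum_bij (fun s _ => Set.range fun a : s.1 => (a.1.1, (s.2 a).1)) ?_ ?_ ?_ ?_
  · rintro ⟨s, g⟩ -
    rw [Set.Finite.mem_toFinset]
    refine ⟨?_, ?_⟩
    · rintro _ ⟨a, rfl⟩
      exact ⟨a.1.2, (g a).2⟩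
    · rintro _ ⟨a, rfl⟩ _ ⟨b, rfl⟩ (h | h)
      · rw [Subtype.ext (Subtype.ext h)]
      · rw [g.injective (Subtype.ext h)]
  · rintro ⟨s, g⟩ - ⟨s', g'⟩ - h
    have key : ∀ (s s' : Finset X) (g : s ↪ Y) (g' : s' ↪ Y),
        (Set.range fun a : s => ((a.1.1, (g a).1) : C × C)) =
          (Set.range fun a : s' => ((a.1.1, (g' a).1) : C × C)) → s ⊆ s' := by
      intro s s' g g' h a ha
      have : ((a.1, (g ⟨a, ha⟩).1) : C × C) ∈
          Set.range fun a : s' => ((a.1.1, (g' a).1) : C × C) := h ▸ ⟨⟨a, ha⟩, rfl⟩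
      obtain ⟨b, hb⟩ := this
      rw [← Subtype.ext (congrArg Prod.fst hb)]
      exact b.2
    obtain rfl : s = s' := (key s s' g g' h).antisymm (key s' s g' g h.symm)
    congr 1
    ext a
    have : ((a.1.1, (g a).1) : C × C) ∈
        Set.range fun a : s => ((a.1.1, (g' a).1) : C × C) := h ▸ ⟨a, rfl⟩
    obtain ⟨b, hb⟩ := this
    obtain rfl : b = a := Subtype.ext (Subtype.ext (congrArg Prod.fst hb))
    exact (congrArg Prod.snd hb).symm
  · intro N hN
    rw [Set.Finite.mem_toFinset] at hN
    have hg : ∀ a : Finset.univ.filter (fun a : X => ∃ b, (a.1, b) ∈ N), ∃ b : Y,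
        (a.1.1, b.1) ∈ N := by
      rintro ⟨a, ha⟩
      obtain ⟨b, hb⟩ := (Finset.mem_filter.1 ha).2
      exact ⟨⟨b, (hN.1 _ hb).2⟩, hb⟩
    choose g hg using hg
    refine ⟨⟨Finset.univ.filter (fun a : X => ∃ b, (a.1, b) ∈ N), ⟨g, fun a b hab => ?_⟩⟩,
      by simp, ?_⟩
    · have := hN.2 _ (hg a) _ (hg b) (.inr (by rw [hab]))
      exact Subtype.ext (Subtype.ext (congrArg Prod.fst this))
    · ext ⟨x, y⟩
      constructor
      · rintro ⟨a, ha⟩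
        exact ha ▸ hg a
      · intro h
        refine ⟨⟨⟨x, (hN.1 _ h).1⟩, Finset.mem_filter.2 ⟨Finset.mem_univ _, y, h⟩⟩, ?_⟩
        exact hN.2 _ (hg _) _ h (.inl rfl)
  · rintro ⟨s, g⟩ -
    rw [← Nat.card_coe_set_eq, Nat.card_range_of_injective (hinj s g), Nat.card_eq_fintype_card,
      Fintype.card_coe]

variable {B : LineSystem} {A A₁ A₂ : Set B.Line} {M N : Set (B.Line × B.Line)} {Γ : HWGraph}

theorem Realizable.numOut_diagram (h : B.Realizable A M) :
    (B.diagram A M).numOut = (B.freeOut A M).ncard := by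
  obtain ⟨Γ, ⟨P⟩⟩ := h
  have hi : Function.Injective fun e : Γ.Outgoing => P.tailLine e.1 :=
    P.tailLine_injective.comp Subtype.val_injective
  rw [P.diagram_eq, ← P.range_tailLine_outgoing, ← Nat.card_coe_set_eq,
    Nat.card_range_of_injective hi]
  rfl

theorem Realizable.numIn_diagram (h : B.Realizable A M) :
    (B.diagram A M).numIn = (B.freeIn A M).ncard := by
  obtain ⟨Γ, ⟨P⟩⟩ := h
  have hi : Function.Injective fun e : Γ.Incoming => P.headLine e.1 :=
    P.headLine_injective.comp Subtype.val_injective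
  rw [P.diagram_eq, ← P.range_headLine_incoming, ← Nat.card_coe_set_eq,
    Nat.card_range_of_injective hi]
  rfl

/-- Each line with a head is inner or incoming. -/
theorem Realizable.numInner_add_numIn_diagram (h : B.Realizable A M) :
    (B.diagram A M).numInner + (B.diagram A M).numIn = {x ∈ A | B.head x ≠ none}.ncard := by
  obtain ⟨Γ, ⟨P⟩⟩ := h
  have hi : Function.Injective fun e : {e : Γ.E // Γ.head e ≠ none} => P.headLine e.1 :=
    P.headLine_injective.comp Subtype.val_injective
  have hr : {x ∈ A | B.head x ≠ none} =
      Set.range fun e : {e : Γ.E // Γ.head e ≠ none} => P.headLine e.1 := by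
    ext x
    constructor
    · rintro ⟨hx, hh⟩
      obtain ⟨e, rfl⟩ := P.exists_headLine hx fun z hz => hh (P.glued _ _ hz).2.2.2
      exact ⟨⟨e, by simpa [P.head_eq] using hh⟩, rfl⟩
    · rintro ⟨e, rfl⟩
      exact ⟨P.headLine_mem _, by simpa [P.head_eq] using e.2⟩
  have hd : {e | Γ.head e ≠ none} =
      {e | Γ.head e ≠ none ∧ Γ.tail e ≠ none} ∪ {e | Γ.tail e = none} := by
    ext e
    have := Γ.attached e
    simp only [Set.mem_ofPred_eq, Set.mem_union]
    tauto
  rw [hr, ← Nat.card_coe_set_eq,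
    Nat.card_range_of_injective hi, P.diagram_eq]
  change Set.ncard {e | Γ.head e ≠ none ∧ Γ.tail e ≠ none} + Set.ncard {e | Γ.tail e = none} =
    Set.ncard {e | Γ.head e ≠ none}
  rw [hd, Set.ncard_union_eq]
  exact Set.disjoint_left.2 fun e h1 h2 => h1.2 h2

theorem Realizable.numInner_diagram (h : B.Realizable A ∅) :
    (B.diagram A ∅).numInner = {x ∈ A | B.head x ≠ none ∧ B.tail x ≠ none}.ncard := by
  have hd : {x ∈ A | B.head x ≠ none} =
      {x ∈ A | B.head x ≠ none ∧ B.tail x ≠ none} ∪ B.freeIn A ∅ := by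
    ext x
    have := B.attached x
    simp only [Set.mem_ofPred_eq, Set.mem_union, freeIn, Set.mem_empty_iff_false,
      not_false_eq_true, implies_true, and_true]
    tauto
  have := h.numInner_add_numIn_diagram
  rw [hd, Set.ncard_union_eq (Set.disjoint_left.2 fun e h1 h2 => h1.2.2 h2.2.1),
    h.numIn_diagram] at this
  omega

theorem ncard_freeOut_union (hd : Disjoint A₂ A₁)
    (hN : N ∈ pairings (B.freeIn A₂ ∅) (B.freeOut A₁ ∅)) :
    (B.freeOut (A₂ ∪ A₁) N).ncard + N.ncard =
      (B.freeOut A₂ ∅).ncard + (B.freeOut A₁ ∅).ncard := by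
  have h1 : N.ncard = (Prod.snd '' N).ncard :=
    (Set.InjOn.ncard_image fun p hp q hq h => hN.2 p hp q hq (.inr h)).symm
  rw [Set.disjoint_left] at hd
  have h2 : B.freeOut (A₂ ∪ A₁) N ∪ Prod.snd '' N = B.freeOut A₂ ∅ ∪ B.freeOut A₁ ∅ := by
    ext x
    simp only [pairings, freeIn, freeOut, Set.mem_union, Set.mem_ofPred_eq, Set.mem_empty_iff_false,
      Set.mem_image] at hN ⊢
    grind
  rw [h1, ← Set.ncard_union_eq, h2, Set.ncard_union_eq]
  · exact Set.disjoint_left.2 fun x h h' => hd h.1 h'.1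
  · rw [Set.disjoint_left]
    rintro _ h ⟨p, hp, rfl⟩
    exact h.2.2 _ hp

theorem ncard_freeIn_union (hd : Disjoint A₂ A₁)
    (hN : N ∈ pairings (B.freeIn A₂ ∅) (B.freeOut A₁ ∅)) :
    (B.freeIn (A₂ ∪ A₁) N).ncard + N.ncard =
      (B.freeIn A₂ ∅).ncard + (B.freeIn A₁ ∅).ncard := by
  have h1 : N.ncard = (Prod.fst '' N).ncard :=
    (Set.InjOn.ncard_image fun p hp q hq h => hN.2 p hp q hq (.inl h)).symm
  rw [Set.disjoint_left] at hd
  have h2 : B.freeIn (A₂ ∪ A₁) N ∪ Prod.fst '' N = B.freeIn A₂ ∅ ∪ B.freeIn A₁ ∅ := by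
    ext x
    simp only [pairings, freeIn, freeOut, Set.mem_union, Set.mem_ofPred_eq, Set.mem_empty_iff_false,
      Set.mem_image] at hN ⊢
    grind
  rw [h1, ← Set.ncard_union_eq, h2, Set.ncard_union_eq]
  · exact Set.disjoint_left.2 fun x h h' => hd h.1 h'.1
  · rw [Set.disjoint_left]
    rintro _ h ⟨p, hp, rfl⟩
    exact h.2.2 _ hp

theorem numInner_diagram_union (h₂ : B.Realizable A₂ ∅) (h₁ : B.Realizable A₁ ∅)
    (hd : Disjoint (B.ends A₂) (B.ends A₁))
    (hN : N ∈ pairings (B.freeIn A₂ ∅) (B.freeOut A₁ ∅)) :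
    (B.diagram (A₂ ∪ A₁) N).numInner =
      (B.diagram A₂ ∅).numInner + (B.diagram A₁ ∅).numInner + N.ncard := by
  have hA := disjoint_of_ends hd
  have h := h₂.union h₁ hd hN
  rw [Set.empty_union, Set.empty_union] at h
  have e₂ := h₂.numInner_add_numIn_diagram
  have e₁ := h₁.numInner_add_numIn_diagram
  have e := h.numInner_add_numIn_diagram
  have hs : {x ∈ A₂ ∪ A₁ | B.head x ≠ none} =
      {x ∈ A₂ | B.head x ≠ none} ∪ {x ∈ A₁ | B.head x ≠ none} := by
    ext x
    simp only [Set.mem_ofPred_eq, Set.mem_union]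
    tauto
  rw [hs, Set.ncard_union_eq (Set.disjoint_left.2 fun x h h' => Set.disjoint_left.1 hA h.1 h'.1)]
    at e
  have := ncard_freeIn_union hA hN
  rw [h.numIn_diagram] at e
  rw [h₂.numIn_diagram] at e₂
  rw [h₁.numIn_diagram] at e₁
  omega

end LineSystem

section NormalOrdering

variable {R : Type*} [Ring R] {x y z : R}

theorem mul_pow_of_commutator (h : y * x = x * y + z) (hx : Commute z x) (k : ℕ) :
    y * x ^ k = x ^ k * y + k • (x ^ (k - 1) * z) := by
  induction k with
  | zero => simp
  | succ k ih =>
    rw [pow_succ, ← mul_assoc, ih, add_mul, mul_assoc, h, mul_add, ← mul_assoc, add_assoc]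
    congr 1
    rw [smul_mul_assoc, mul_assoc, hx.eq, ← mul_assoc, Nat.add_sub_cancel, succ_nsmul']
    congr 1
    rcases k with _ | k
    · simp
    · rw [Nat.add_sub_cancel, ← pow_succ]

/-- The normal ordering of `y ^ l * x ^ k` when the commutator `z` of `y` and `x` is central. For
`k < i`, where the exponent `k - i` is truncated, the falling factorial vanishes. -/
theorem pow_mul_pow_of_commutator (h : y * x = x * y + z) (hx : Commute z x) (hy : Commute z y)
    (l k : ℕ) : y ^ l * x ^ k = ∑ i ∈ Finset.range (l + 1),
      l.choose i • k.descFactorial i • (x ^ (k - i) * y ^ (l - i) * z ^ i) := by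
  induction l with
  | zero => simp
  | succ l ih =>
    have e : ∀ i ∈ Finset.range (l + 1),
        y * (l.choose i • k.descFactorial i • (x ^ (k - i) * y ^ (l - i) * z ^ i)) =
          l.choose i • k.descFactorial i • (x ^ (k - i) * y ^ (l + 1 - i) * z ^ i) +
          l.choose i • k.descFactorial (i + 1) •
            (x ^ (k - (i + 1)) * y ^ (l + 1 - (i + 1)) * z ^ (i + 1)) := by
      intro i hi
      have hi' : l + 1 - i = (l - i) + 1 := by
        have := Finset.mem_range.1 hi
        omega
      rw [mul_smul_comm, mul_smul_comm, ← mul_assoc, ← mul_assoc, mul_pow_of_commutator h hx,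
        add_mul, add_mul, smul_add, smul_add, hi', pow_succ' y, mul_assoc (x ^ (k - i)) y]
      congr 2
      rw [Nat.descFactorial_succ, mul_comm, mul_smul, smul_mul_assoc, smul_mul_assoc,
        Nat.add_sub_add_right, pow_succ' z, mul_assoc _ z, (hy.pow_right _).eq, ← Nat.sub_sub]
      simp only [mul_assoc]
    rw [pow_succ', mul_assoc, ih, Finset.mul_sum, Finset.sum_congr rfl e, Finset.sum_add_distrib]
    rw [Finset.sum_range_succ' _ (l + 1)]
    simp only [Nat.choose_succ_succ, add_smul, Finset.sum_add_distrib]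
    rw [Finset.sum_range_succ' _ l, Finset.sum_range_succ (n := l) (f := fun i =>
      l.choose (i + 1) • k.descFactorial (i + 1) •
        (x ^ (k - (i + 1)) * y ^ (l + 1 - (i + 1)) * z ^ (i + 1)))]
    simp
    abel

end NormalOrdering

/-! ### The forgetful mapping -/

/-- The binomial theorem, with the terms indexed by subsets. -/
theorem Commute.add_pow_ncard {R : Type*} [Semiring R] {C : Type*} [Finite C] {a b : R}
    (h : Commute a b) (X : Set C) :
    (a + b) ^ X.ncard = ∑ S ∈ (𝒫 X).toFinite.toFinset, a ^ S.ncard * b ^ (X \ S).ncard := by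
  classical
  have hX := X.toFinite
  have e : ∑ S ∈ (𝒫 X).toFinite.toFinset, a ^ S.ncard * b ^ (X \ S).ncard =
      ∑ s ∈ hX.toFinset.powerset, a ^ s.card * b ^ (X.ncard - s.card) := by
    refine Finset.sum_bij' (fun S _ => S.toFinite.toFinset) (fun s _ => (s : Set C)) ?_ ?_ ?_ ?_ ?_
    · intro S hS
      simpa using hS
    · intro s hs
      rw [Finset.mem_powerset] at hs
      rw [Set.Finite.mem_toFinset]
      exact fun x hx => hX.mem_toFinset.1 (hs hx)
    · simp
    · simp
    · intro S hS
      rw [Set.Finite.mem_toFinset] at hS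
      rw [Set.ncard_sdiff hS, Set.ncard_eq_toFinset_card]
  rw [e, Finset.sum_powerset_apply_card (fun i => a ^ i * b ^ (X.ncard - i)), h.add_pow,
    ← Set.ncard_eq_toFinset_card X]
  refine Finset.sum_congr rfl fun i _ => ?_
  rw [nsmul_eq_mul']

namespace LineSystem

variable {B : LineSystem} {A : Set B.Line}

/-- A subset of a disjoint union of three sets amounts to three subsets. -/
theorem sum_powerset_split {R : Type*} [AddCommMonoid R] {X Y Z : Set B.Line}
    (hA : A = X ∪ Y ∪ Z) (hXY : Disjoint X Y) (hXZ : Disjoint X Z) (hYZ : Disjoint Y Z)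
    (F : Set B.Line → Set B.Line → Set B.Line → R) :
    ∑ D ∈ (𝒫 A).toFinite.toFinset, F (D ∩ X) (D ∩ Y) (D ∩ Z) =
      ∑ S ∈ (𝒫 X).toFinite.toFinset, ∑ T ∈ (𝒫 Y).toFinite.toFinset,
        ∑ U ∈ (𝒫 Z).toFinite.toFinset, F S T U := by
  simp only [Finset.sum_sigma']
  rw [Set.disjoint_left] at hXY hXZ hYZ
  refine Finset.sum_bij' (fun D _ => ⟨D ∩ X, D ∩ Y, D ∩ Z⟩) (fun s _ => s.1 ∪ s.2.1 ∪ s.2.2)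
    ?_ ?_ ?_ ?_ ?_
  · intro D _
    simp
  · rintro ⟨S, T, U⟩ h
    simp only [Finset.mem_sigma, Set.Finite.mem_toFinset, Set.mem_powerset_iff] at h ⊢
    rw [hA]
    exact Set.union_subset_union (Set.union_subset_union h.1 h.2.1) h.2.2
  · intro D hD
    rw [Set.Finite.mem_toFinset] at hD
    simp only
    rw [← Set.inter_union_distrib_left, ← Set.inter_union_distrib_left, ← hA]
    exact Set.inter_eq_left.2 hD
  · rintro ⟨S, T, U⟩ h
    simp only [Finset.mem_sigma, Set.Finite.mem_toFinset, Set.mem_powerset_iff,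
      Set.subset_def] at h
    simp only [Sigma.mk.injEq, heq_eq_eq, Set.ext_iff, Set.mem_union, Set.mem_inter_iff]
    grind
  · intro D _
    rfl

end LineSystem

namespace DiagramAlg

section Forgetful

open LineSystem UniversalEnvelopingAlgebra HeisenbergLie

variable (K : Type*) [Field K]

attribute [local instance 100] LieRing.ofAssociativeRing

theorem ι_a_mul_ι_aDag : ι K (a K) * ι K (aDag K) =
    ι K (aDag K) * ι K (a K) + ι K (e K) := by
  rw [← lie_a_aDag, LieHom.map_lie, LieRing.of_associative_ring_bracket]
  abel

theorem commute_ι_e_aDag : Commute (ι K (e K)) (ι K (aDag K)) := by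
  have h : ⁅ι K (aDag K), ι K (e K)⁆ = 0 := by rw [← LieHom.map_lie, lie_aDag_e, map_zero]
  rw [LieRing.of_associative_ring_bracket, sub_eq_zero] at h
  exact h.symm

theorem commute_ι_e_a : Commute (ι K (e K)) (ι K (a K)) := by
  have h : ⁅ι K (a K), ι K (e K)⁆ = 0 := by rw [← LieHom.map_lie, lie_a_e, map_zero]
  rw [LieRing.of_associative_ring_bracket, sub_eq_zero] at h
  exact h.symm

theorem forgetful_of (D : Diagram) : forgetful K (of K D) =
    ι K (aDag K) ^ D.numOut * ι K (a K) ^ D.numIn * ι K (e K) ^ D.numInner := by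
  simp [forgetful, of]

theorem forgetful_one : forgetful K (one K) = 1 := by
  have h0 : ∀ p : Empty → Prop, Nat.card {e // p e} = 0 := fun p => Nat.card_of_isEmpty
  have h1 : Diagram.void.numOut = 0 := h0 _
  have h2 : Diagram.void.numIn = 0 := h0 _
  have h3 : Diagram.void.numInner = 0 := h0 _
  rw [one, forgetful_of, h1, h2, h3]
  simp

theorem forgetful_mul_of (Γ₂ Γ₁ : HWGraph) :
    forgetful K (mul K (of K (.mk Γ₂)) (of K (.mk Γ₁))) =
      forgetful K (of K (.mk Γ₂)) * forgetful K (of K (.mk Γ₁)) := by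
  obtain ⟨B, -, A₂, A₁, -, ⟨P₂⟩, ⟨P₁⟩, -, hd, -⟩ :=
    HWGraph.exists_disjoint_triple HWGraph.void Γ₂ Γ₁
  have hA := disjoint_of_ends hd
  rw [← P₂.diagram_eq, ← P₁.diagram_eq, mul_of,
    mulDiagram_diagram K P₂.realizable P₁.realizable hd, map_sum]
  have hterm : ∀ N ∈ (pairings (B.freeIn A₂ ∅) (B.freeOut A₁ ∅)).toFinite.toFinset,
      forgetful K (of K (B.diagram (A₂ ∪ A₁) (∅ ∪ ∅ ∪ N))) =
        ι K (aDag K) ^ (B.diagram A₂ ∅).numOut *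
          (ι K (aDag K) ^ ((B.diagram A₁ ∅).numOut - N.ncard) *
            ι K (a K) ^ ((B.diagram A₂ ∅).numIn - N.ncard) * ι K (e K) ^ N.ncard) *
          (ι K (a K) ^ (B.diagram A₁ ∅).numIn *
            ι K (e K) ^ ((B.diagram A₂ ∅).numInner + (B.diagram A₁ ∅).numInner)) := by
    intro N hN
    rw [Set.Finite.mem_toFinset] at hN
    have hr := P₂.realizable.union P₁.realizable hd hN
    rw [Set.empty_union, Set.empty_union] at hr ⊢
    have ho := ncard_freeOut_union hA hN
    have hi := ncard_freeIn_union hA hN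
    have hNo : N.ncard ≤ (B.freeOut A₁ ∅).ncard := by
      rw [← Set.InjOn.ncard_image (f := Prod.snd) fun p hp q hq h => hN.2 p hp q hq (.inr h)]
      refine Set.ncard_le_ncard ?_
      rintro _ ⟨p, hp, rfl⟩
      exact (hN.1 p hp).2
    have hNi : N.ncard ≤ (B.freeIn A₂ ∅).ncard := by
      rw [← Set.InjOn.ncard_image (f := Prod.fst) fun p hp q hq h => hN.2 p hp q hq (.inl h)]
      refine Set.ncard_le_ncard ?_
      rintro _ ⟨p, hp, rfl⟩
      exact (hN.1 p hp).1
    rw [forgetful_of, numInner_diagram_union P₂.realizable P₁.realizable hd hN,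
      hr.numOut_diagram, hr.numIn_diagram, P₂.realizable.numOut_diagram,
      P₁.realizable.numOut_diagram, P₂.realizable.numIn_diagram, P₁.realizable.numIn_diagram]
    have ho' : (B.freeOut (A₂ ∪ A₁) N).ncard =
        (B.freeOut A₂ ∅).ncard + ((B.freeOut A₁ ∅).ncard - N.ncard) := by omega
    have hi' : (B.freeIn (A₂ ∪ A₁) N).ncard =
        ((B.freeIn A₂ ∅).ncard - N.ncard) + (B.freeIn A₁ ∅).ncard := by omega
    rw [ho', hi', pow_add, pow_add, pow_add _ _ N.ncard]
    have key : ∀ p q r s t u : UH K, Commute u s → Commute u t →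
        p * q * (r * s) * (t * u) = p * (q * r * u) * (s * t) := by
      intro p q r s t u hs ht
      simp only [mul_assoc]
      rw [← mul_assoc u s, hs.eq, mul_assoc, ht.eq]
    exact key _ _ _ _ _ _ ((commute_ι_e_a K).pow_pow _ _) ((Commute.refl _).pow_pow _ _)
  rw [Finset.sum_congr rfl hterm, sum_pairings_ncard _ _ fun n => ι K (aDag K) ^
    (B.diagram A₂ ∅).numOut * (ι K (aDag K) ^ ((B.diagram A₁ ∅).numOut - n) *
      ι K (a K) ^ ((B.diagram A₂ ∅).numIn - n) * ι K (e K) ^ n) *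
    (ι K (a K) ^ (B.diagram A₁ ∅).numIn *
      ι K (e K) ^ ((B.diagram A₂ ∅).numInner + (B.diagram A₁ ∅).numInner)),
    ← P₂.realizable.numIn_diagram, ← P₁.realizable.numOut_diagram]
  trans ι K (aDag K) ^ (B.diagram A₂ ∅).numOut *
    (ι K (a K) ^ (B.diagram A₂ ∅).numIn * ι K (aDag K) ^ (B.diagram A₁ ∅).numOut) *
    (ι K (a K) ^ (B.diagram A₁ ∅).numIn *
      ι K (e K) ^ ((B.diagram A₂ ∅).numInner + (B.diagram A₁ ∅).numInner))
  · rw [pow_mul_pow_of_commutator (ι_a_mul_ι_aDag K) (commute_ι_e_aDag K) (commute_ι_e_a K),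
      Finset.mul_sum, Finset.sum_mul]
    exact Finset.sum_congr rfl fun i _ => by simp only [mul_smul_comm, smul_mul_assoc]
  rw [forgetful_of, forgetful_of, pow_add]
  have key : ∀ p q r s t u : UH K, Commute u r → Commute u s →
      p * (q * r) * (s * (u * t)) = p * q * u * (r * s * t) := by
    intro p q r s t u hr hs
    simp only [mul_assoc]
    rw [← mul_assoc s u, ← hs.eq, mul_assoc, ← mul_assoc r u, ← hr.eq, mul_assoc]
  exact key _ _ _ _ _ _ ((commute_ι_e_aDag K).pow_pow _ _) ((commute_ι_e_a K).pow_pow _ _)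

theorem forgetful_mul (x y : DiagramAlg K) :
    forgetful K (mul K x y) = forgetful K x * forgetful K y := by
  induction x using induction_of with
  | zero => simp
  | add x x' hx hx' => simp [hx, hx', add_mul]
  | smul c x hx => simp [hx]
  | of Γ₂ =>
  induction y using induction_of with
  | zero => simp
  | add x x' hx hx' => simp [hx, hx', mul_add]
  | smul c x hx => simp [hx]
  | of Γ₁ => exact forgetful_mul_of K Γ₂ Γ₁

theorem comul_ι (x : HeisenbergLie K) : Coalgebra.comul (R := K) (ι K x) =
    ι K x ⊗ₜ[K] (1 : UH K) + (1 : UH K) ⊗ₜ[K] ι K x :=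
  comulHom_ι K x

theorem comul_ι_pow_ncard (x : HeisenbergLie K) {C : Type} [Finite C] (X : Set C) :
    Coalgebra.comul (R := K) (ι K x ^ X.ncard) =
      ∑ S ∈ (𝒫 X).toFinite.toFinset, (ι K x ^ S.ncard) ⊗ₜ[K] (ι K x ^ (X \ S).ncard) := by
  have h : Commute (ι K x ⊗ₜ[K] (1 : UH K)) ((1 : UH K) ⊗ₜ[K] ι K x) := by
    simp [Commute, SemiconjBy, Algebra.TensorProduct.tmul_mul_tmul]
  rw [Bialgebra.comul_pow, comul_ι, h.add_pow_ncard]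
  refine Finset.sum_congr rfl fun S _ => ?_
  rw [Algebra.TensorProduct.tmul_pow, Algebra.TensorProduct.tmul_pow, one_pow, one_pow,
    Algebra.TensorProduct.tmul_mul_tmul, mul_one, one_mul]

theorem forgetful_comul_of (Γ : HWGraph) :
    TensorProduct.map (forgetful K) (forgetful K) (comul K (of K (.mk Γ))) =
      Coalgebra.comul (R := K) (forgetful K (of K (.mk Γ))) := by
  have P := Γ.gluing
  set B := Γ.lineSystem
  have hr := fun D => P.realizable.mono (Set.subset_univ D)
  let X : Set B.Line := {x | B.head x = none}
  let Y : Set B.Line := {x | B.tail x = none}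
  let Z : Set B.Line := {x | B.head x ≠ none ∧ B.tail x ≠ none}
  have hf : ∀ D : Set B.Line, forgetful K (of K (B.diagram D ∅)) =
      ι K (aDag K) ^ (D ∩ X).ncard * ι K (a K) ^ (D ∩ Y).ncard * ι K (e K) ^ (D ∩ Z).ncard := by
    intro D
    have hX : B.freeOut D ∅ = D ∩ X := by
      ext x
      simp [freeOut, X]
    have hY : B.freeIn D ∅ = D ∩ Y := by
      ext x
      simp [freeIn, Y]
    rw [forgetful_of, (hr D).numOut_diagram, (hr D).numIn_diagram, (hr D).numInner_diagram, hX, hY]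
    rfl
  have hXYZ : Set.univ = X ∪ Y ∪ Z := by
    ext x
    simp only [X, Y, Z, Set.mem_union, Set.mem_ofPred_eq, Set.mem_univ, true_iff]
    tauto
  have hd : ∀ D W : Set B.Line, (Set.univ \ D) ∩ W = W \ (D ∩ W) := by
    intro D W
    ext x
    simp only [Set.mem_inter_iff, Set.mem_sdiff, Set.mem_univ, true_and]
    tauto
  rw [← P.diagram_eq, comul_of, comulDiagram_diagram_empty K P.realizable, map_sum]
  simp only [TensorProduct.map_tmul, hf, hd]
  rw [sum_powerset_split hXYZ
    (Set.disjoint_left.2 fun x h1 h2 => (B.attached x).elim (· h1) (· h2))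
    (Set.disjoint_left.2 fun x h1 h2 => h2.1 h1) (Set.disjoint_left.2 fun x h1 h2 => h2.2 h1)
    fun S T U => (ι K (aDag K) ^ S.ncard * ι K (a K) ^ T.ncard * ι K (e K) ^ U.ncard) ⊗ₜ[K]
      (ι K (aDag K) ^ (X \ S).ncard * ι K (a K) ^ (Y \ T).ncard * ι K (e K) ^ (Z \ U).ncard)]
  rw [Set.univ_inter, Set.univ_inter, Set.univ_inter, Bialgebra.comul_mul, Bialgebra.comul_mul,
    comul_ι_pow_ncard, comul_ι_pow_ncard, comul_ι_pow_ncard]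
  rw [Finset.sum_mul_sum, Finset.sum_mul]
  refine Finset.sum_congr rfl fun S _ => ?_
  rw [Finset.sum_mul]
  refine Finset.sum_congr rfl fun T _ => ?_
  rw [Finset.mul_sum]
  refine Finset.sum_congr rfl fun U _ => ?_
  rw [Algebra.TensorProduct.tmul_mul_tmul, Algebra.TensorProduct.tmul_mul_tmul]

theorem forgetful_counit_of (Γ : HWGraph) :
    counit K (of K (.mk Γ)) = Coalgebra.counit (R := K) (forgetful K (of K (.mk Γ))) := by
  have h : ∀ x : HeisenbergLie K, Coalgebra.counit (R := K) (ι K x) = 0 := counitHom_ι K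
  rcases isEmpty_or_nonempty Γ.E with hE | ⟨⟨x⟩⟩
  · rw [of_eq_one K Γ, forgetful_one, counit_one, Bialgebra.counit_one]
  · have hE : Nonempty Γ.E := ⟨x⟩
    rw [counit_mk_of_nonempty, forgetful_of, Bialgebra.counit_mul, Bialgebra.counit_mul,
      Bialgebra.counit_pow, Bialgebra.counit_pow, Bialgebra.counit_pow, h, h, h]
    by_cases hh : Γ.head x = none
    · have : (Diagram.mk Γ).numOut ≠ 0 :=
        have : Nonempty Γ.Outgoing := ⟨⟨x, hh⟩⟩
        Nat.card_pos.ne'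
      rw [zero_pow this, zero_mul, zero_mul]
    by_cases ht : Γ.tail x = none
    · have : (Diagram.mk Γ).numIn ≠ 0 :=
        have : Nonempty Γ.Incoming := ⟨⟨x, ht⟩⟩
        Nat.card_pos.ne'
      rw [zero_pow this, mul_zero, zero_mul]
    · have : (Diagram.mk Γ).numInner ≠ 0 :=
        have : Nonempty Γ.Inner := ⟨⟨x, hh, ht⟩⟩
        Nat.card_pos.ne'
      rw [zero_pow this, mul_zero]

theorem forgetful_comul : TensorProduct.map (forgetful K) (forgetful K) ∘ₗ comul K =
    Coalgebra.comul ∘ₗ forgetful K :=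
  hom_ext_mk K (forgetful_comul_of K)

theorem forgetful_counit : counit K = Coalgebra.counit ∘ₗ forgetful K :=
  hom_ext_mk K (forgetful_counit_of K)

/-- The forgetful mapping as an algebra morphism. -/
def forgetfulAlgHom : DiagramAlg K →ₐ[K] UH K :=
  AlgHom.ofLinearMap (forgetful K) (forgetful_one K) (forgetful_mul K)

/-- The forgetful mapping as a coalgebra morphism. -/
def forgetfulCoalgHom : DiagramAlg K →ₗc[K] UH K where
  __ := forgetful K
  counit_comp := (forgetful_counit K).symm
  map_comp_comul := forgetful_comul K

open WithConv in
theorem forgetful_antipode :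
    forgetful K ∘ₗ antipode K = HopfAlgebra.antipode K ∘ₗ forgetful K := by
  -- both sides are convolution inverses of the forgetful mapping
  have hl : toConv (HopfAlgebra.antipode K ∘ₗ forgetful K) * toConv (forgetful K) = 1 := by
    have := LinearMap.convMul_comp_coalgHom_distrib
      (toConv (HopfAlgebra.antipode K)) (toConv LinearMap.id) (forgetfulCoalgHom K)
    rw [LinearMap.antipode_mul_id] at this
    refine Eq.trans (ofConv_injective this.symm) ?_
    refine ofConv_injective ?_
    change (Algebra.linearMap K (UH K) ∘ₗ Coalgebra.counit) ∘ₗ forgetful K =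
      Algebra.linearMap K (UH K) ∘ₗ counit K
    rw [LinearMap.comp_assoc, forgetful_counit]
  have hr : toConv (forgetful K) * toConv (forgetful K ∘ₗ antipode K) = 1 := by
    have := LinearMap.algHom_comp_convMul_distrib (forgetfulAlgHom K)
      (toConv LinearMap.id) (toConv (antipode K))
    rw [id_convMul_antipode] at this
    refine Eq.trans (ofConv_injective this.symm) ?_
    refine ofConv_injective (LinearMap.ext fun x => ?_)
    exact (forgetfulAlgHom K).commutes _
  exact toConv_injective (left_inv_eq_right_inv hl hr).symm

end Forgetful

end DiagramAlg

end

theorem theorem4 (K : Type*) [Field K] :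
    IsHopfAlgebra (DiagramAlg.mul K) (DiagramAlg.one K) (DiagramAlg.comul K)
      (DiagramAlg.counit K) (DiagramAlg.antipode K) ∧
    (∀ x y, forgetful K (DiagramAlg.mul K x y) = forgetful K x * forgetful K y) ∧
    forgetful K (DiagramAlg.one K) = 1 ∧
    TensorProduct.map (forgetful K) (forgetful K) ∘ₗ DiagramAlg.comul K =
      Coalgebra.comul ∘ₗ forgetful K ∧
    DiagramAlg.counit K = Coalgebra.counit ∘ₗ forgetful K ∧
    forgetful K ∘ₗ DiagramAlg.antipode K = HopfAlgebra.antipode K ∘ₗ forgetful K :=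
  ⟨DiagramAlg.isHopfAlgebra K, DiagramAlg.forgetful_mul K, DiagramAlg.forgetful_one K,
    DiagramAlg.forgetful_comul K, DiagramAlg.forgetful_counit K, DiagramAlg.forgetful_antipode K⟩
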